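/- A Takagi factorization of a complex symmetric matrix $A\in\mathbb C^{n\times n}$ is $A=USU^T$ with $U$ unitary and $S=\operatorname{diag}(s_1,\dots,s_n)$, $s_1\ge\dots\ge s_n\ge 0$ (so the $s_i$ are the singular values of $A$). Let $\Omega\subset\mathbb R^2$ be compact, $k\ge 0$ (or $k=\infty$), and let $A\in\mathcal C^k(\Omega,\mathbb C^{n\times n})$ satisfy $A^T=A$ on $\Omega$, with ordered singular values $\sigma_1\ge\dots\ge\sigma_n\ge 0$. Let $\Gamma\subset\Omega$ be a simple closed curve, parametrized by a $\mathcal C^k$ function $\gamma:[0,1]\to\mathbb R^2$ with $\gamma(0)=\gamma(1)$ and $\gamma$ injective on $[0,1)$, and suppose that all points enclosed by $\Gamma$ (those lying in a bounded connected component of $\mathbb R^2\setminus\Gamma$) belong to $\Omega$. Assume that along $\Gamma$ the singular values are nonzero and pairwise distinct. Write $A=B+iC$ with $B,C$ real, and let $\lambda_1\ge\dots\ge\lambda_{2n}$ be the ordered eigenvalues of the real symmetric matrix function $M=\begin{pmatrix}B&C\\ C&-B\end{pmatrix}$; thus $\lambda_i=\sigma_i$ and $\lambda_{2n+1-i}=-\sigma_i$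 for $1\le i\le n$. A point $x$ enclosed by $\Gamma$ is called a generic coalescing point of $\lambda_i,\lambda_{i+1}$ if $\lambda_i(x)=\lambda_{i+1}(x)$, $M$ is differentiable at $x$ (automatic if $k\ge1$), and the two eigenvalue surfaces meet at $x$ as a nondegenerate double cone: there are a linear form $\ell$ and an invertible linear map $L$ of $\mathbb R^2$ with $$\lambda_i(y)=\lambda_i(x)+\ell(y-x)+\|L(y-x)\|+o(\|y-x\|),\qquad \lambda_{i+1}(y)=\lambda_i(x)+\ell(y-x)-\|L(y-x)\|+o(\|y-x\|)\qquad (y\to x).$$ Let $A(\gamma(0))=U_0S_0U_0^T$ be a given Takagi factorization. Then there are unique $\mathcal C^k$ functions $U,S$ on $[0,1]$ such that $A(\gamma(t))=U(t)S(t)U(t)^T$ is a Takagi factorization for every $t$ and $U(0)=U_0$, $S(0)=S_0$. Write $U(t)=[u_1(t)\ \cdots\ u_n(t)]$. (a) Suppose that for some $1\le j\le n-1$ and some point $x$ enclosed by $\Gamma$, $x$ is a generic coalescing point of $\lambda_j,\lambda_{j+1}$, and that $\sigma_j(x)=\sigma_{j+1}(x)$ is the only degeneracy in $\Omega$: for $y\in\Omega$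 and $1\le i\le n-1$ one has $\sigma_i(y)=\sigma_{i+1}(y)$ if and only if $y=x$ and $i=j$, and no singular value vanishes in $\Omega$. Then $$u_j(1)=-u_j(0),\qquad u_{j+1}(1)=-u_{j+1}(0),\qquad u_c(1)=u_c(0)\quad\text{for } c\ne j,j+1.$$ (b) Let $n\ge1$. Suppose that $\sigma_n$ vanishes in $\Omega$ exactly at one point $x$, that $x$ is enclosed by $\Gamma$ and is a generic coalescing point of $\lambda_n,\lambda_{n+1}$, and that $\sigma_{n-1}\ne\sigma_n$ everywhere in $\Omega$ (no condition if $n=1$). Then $u_n(1)=-u_n(0)$. -/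

import Mathlib

open Set Filter Topology Matrix
open scoped ContDiff

noncomputable section

namespace Takagi

/-- The parameter plane `ℝ²` with its Euclidean norm. -/
abbrev Plane := EuclideanSpace ℝ (Fin 2)

/-- `A = U S Uᵀ` with `U` unitary and `S` diagonal with ordered, nonnegative diagonal entries
`S 0 ≥ S 1 ≥ ... ≥ 0`. -/
structure IsTakagi {n : ℕ} (A U : Matrix (Fin n) (Fin n) ℂ) (S : Fin n → ℝ) : Prop where
  unitary : U ∈ Matrix.unitaryGroup (Fin n) ℂ
  antitone : Antitone S
  nonneg : ∀ i, 0 ≤ S i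
  factor : A = U * Matrix.diagonal (fun i => (S i : ℂ)) * Uᵀ

/-- `A t = U t * S t * (U t)ᵀ` is a Takagi factorization for every `t ∈ [0,1]`, and the entries of
`U` and `S` are of class `C^k` on `[0,1]`. -/
structure IsSmoothTakagi {n : ℕ} (k : ℕ∞) (A U : ℝ → Matrix (Fin n) (Fin n) ℂ)
    (S : ℝ → Fin n → ℝ) : Prop where
  takagi : ∀ t ∈ Icc (0 : ℝ) 1, IsTakagi (A t) (U t) (S t)
  contDiffOn_unitary : ∀ r c, ContDiffOn ℝ k (fun t => U t r c) (Icc 0 1)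
  contDiffOn_diag : ∀ i, ContDiffOn ℝ k (fun t => S t i) (Icc 0 1)

/-- The singular values of a complex matrix in decreasing order, counted with multiplicity and
indexed from `0`: the usual `σ_1 ≥ ... ≥ σ_n` are `singularValue A 0, ..., singularValue A (n-1)`.
(The value is `0` for an index `≥ n`.) -/
def singularValue {n : ℕ} (A : Matrix (Fin n) (Fin n) ℂ) (i : ℕ) : ℝ :=
  (Matrix.toEuclideanLin A).singularValues i

/-- For `A = B + iC`, the real matrix with block rows `(B, C)` and `(C, -B)`. -/
def realForm {n : ℕ} (A : Matrix (Fin n) (Fin n) ℂ) : Matrix (Fin n ⊕ Fin n) (Fin n ⊕ Fin n) ℝ :=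
  Matrix.fromBlocks (A.map Complex.re) (A.map Complex.im) (A.map Complex.im) (-A.map Complex.re)

/-- The `i`-th (indexed from `0`) real eigenvalue of `M`, the eigenvalues being listed in
decreasing order with their multiplicities. -/
def orderedEigenvalue {m : Type*} [Fintype m] [DecidableEq m] (M : Matrix m m ℝ) (i : ℕ) : ℝ :=
  (M.charpoly.roots.sort (· ≥ ·)).getD i 0

/-- The graphs of `f ≥ g` come together at `x` as a (possibly tilted, elliptic) nondegenerate
double cone: up to `o(‖y - x‖)`, they agree with `f x + ℓ (y - x) ± ‖L (y - x)‖` for a linear form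
`ℓ` and an invertible linear map `L` of the plane. -/
def IsDoubleCone (f g : Plane → ℝ) (x : Plane) : Prop :=
  f x = g x ∧ ∃ (l : Plane →L[ℝ] ℝ) (L : Plane →L[ℝ] Plane), Function.Injective L ∧
    (fun y => f y - (f x + l (y - x) + ‖L (y - x)‖)) =o[𝓝 x] (fun y => y - x) ∧
    (fun y => g y - (g x + l (y - x) - ‖L (y - x)‖)) =o[𝓝 x] (fun y => y - x)

/-- `x` is a generic coalescing point of the consecutive ordered eigenvalues with indices `i` and
`i + 1` (from `0`) of the family `M` of real symmetric matrices: `M` is differentiable at `x`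
and the two eigenvalue surfaces come together at `x` as a double cone. -/
def IsGenericCoalescing {m : Type*} [Fintype m] [DecidableEq m] (M : Plane → Matrix m m ℝ)
    (i : ℕ) (x : Plane) : Prop :=
  (∀ r c, DifferentiableAt ℝ (fun y => M y r c) x) ∧
    IsDoubleCone (fun y => orderedEigenvalue (M y) i) (fun y => orderedEigenvalue (M y) (i + 1)) x

/-- The points enclosed by a closed curve with image `C`: those off `C` that lie in a bounded
connected component of the complement of `C`. -/
def inside (C : Set Plane) : Set Plane :=
  {y | y ∉ C ∧ Bornology.IsBounded (connectedComponentIn Cᶜ y)}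

end Takagi

end

/-!
Why the theorem is true. Write `A = B + iC`. In real coordinates `u ↦ (Re u, Im u)`, the symmetric
matrix `realForm A` is the antilinear map `u ↦ A ū`, so the columns of a Takagi factor are unit
eigenvectors of `realForm A` for the eigenvalues `σ_i`, the other eigenvalues being `-σ_i`
(`charpoly_realForm`, `IsTakagi.realForm_mulVec_col`, `isTakagi_of_eigenvectors`). Where the `σ_i` are
distinct and nonzero, each column is thus determined up to a sign, and the continuation along a path
is a lift of a continuous family of lines (`HasLift`). Such a lift exists over an interval
(`hasLift_Icc`), is unique up to a sign, and is as smooth as `A`, by the implicit function theorem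
(`contDiffOn_eigenvector`).

The monodromy is treated without the Jordan curve theorem. Let a family of lines be given on the curve
`Γ` and its enclosed region, except at an enclosed point `x`. If it has a lift over `Γ`, then the
lift allows to extend the family by a family with a lift to the rest of the plane; a large circle
around `x` is homotopic to a small one in the punctured plane, so there is a lift over small circles
around `x` (`hasLift_sphere_of_hasLift_curve`). Hence there is no lift over `Γ` if the lines at
`x + h` and `x - h` are independent for small `h`, because on a small circle a skew form applied to
the lift at antipodal points would be an odd function without zeros (`not_hasLift_of_antipodal`).

This criterion applies to the eigenlines of two generically coalescing eigenvalues. To first order,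
the eigenvectors at `x ± h` are those of a compressed derivative that is odd in `h`, and they
belong to its distinct eigenvalues `ℓ h ± ‖L h‖` (`eventually_independent_of_cone`). The corresponding
columns change their sign. A family of lines that is defined at `x` as well has a lift over `Γ`
(`lift_closed_of_enclosed`): the criterion applies both to the Möbius family of half-angle lines
around `x` and to its tensor product with the given family. So both change the sign along `Γ`, and the
given family does not.
-/

namespace Takagi

/-! ### Continuous families of lines -/

variable {X ι : Type*} [TopologicalSpace X]

/-- A line in `ℝ^ι`, encoded by a rank-one matrix `w wᵀ` with `w ≠ 0`; the vector `w` can be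
recovered from the matrix up to sign. -/
def IsLine (Q : Matrix ι ι ℝ) : Prop := ∃ w : ι → ℝ, w ≠ 0 ∧ Q = vecMulVec w w

/-- A continuous choice of one of the two vectors `±v t` with `P t = (v t) (v t)ᵀ`, that is, a
global section of the double cover belonging to the family of lines `P`. -/
def HasLift (P : X → Matrix ι ι ℝ) : Prop :=
  ∃ v : X → ι → ℝ, Continuous v ∧ ∀ t, P t = vecMulVec (v t) (v t)

theorem eq_or_eq_neg_of_vecMulVec_eq {v w : ι → ℝ}
    (h : vecMulVec v v = vecMulVec w w) : v = w ∨ v = -w := by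
  have h' : ∀ i j, v i * v j = w i * w j := fun i j => congrFun (congrFun h i) j
  by_cases hw : ∀ i, w i = 0
  · left
    ext i
    have := h' i i
    rw [hw i] at this ⊢
    simpa using this
  · push Not at hw
    obtain ⟨i, hi⟩ := hw
    rcases mul_self_eq_mul_self_iff.1 (h' i i) with e | e
    · left
      ext j
      have := h' i j
      rw [e] at this
      exact mul_left_cancel₀ hi this
    · right
      ext j
      have := h' i j
      rw [e] at this
      apply mul_left_cancel₀ hi
      simp only [Pi.neg_apply]
      linarith

theorem isLine_vecMulVec {w : ι → ℝ} (h : w ≠ 0) : IsLine (vecMulVec w w) := ⟨w, h, rfl⟩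

/-- A lift along a parametrized simple closed curve that takes the same value at both ends descends
to the curve itself. -/
theorem hasLift_image_of_closed {Y : Type*} [TopologicalSpace Y] [T2Space Y] {γ : ℝ → Y}
    (hγ : ContinuousOn γ (Icc 0 1)) (hsimple : InjOn γ (Ico 0 1)) (hclosed : γ 0 = γ 1)
    {P : Y → Matrix ι ι ℝ} {v : ℝ → ι → ℝ} (hv : ContinuousOn v (Icc 0 1))
    (hP : ∀ t ∈ Icc (0 : ℝ) 1, P (γ t) = vecMulVec (v t) (v t)) (hv01 : v 0 = v 1) :
    HasLift (fun y : γ '' Icc 0 1 => P y) := by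
  have h01 : ∀ s ∈ Icc (0 : ℝ) 1, ∃ t ∈ Ico (0 : ℝ) 1, γ s = γ t ∧ v s = v t := by
    intro s hs
    rcases eq_or_lt_of_le hs.2 with rfl | h
    · exact ⟨0, by simp, hclosed.symm, hv01.symm⟩
    · exact ⟨s, ⟨hs.1, h⟩, rfl, rfl⟩
  have hwd : ∀ s ∈ Icc (0 : ℝ) 1, ∀ t ∈ Icc (0 : ℝ) 1, γ s = γ t → v s = v t := by
    intro s hs t ht h
    obtain ⟨s', hs', e1, e2⟩ := h01 s hs
    obtain ⟨t', ht', e3, e4⟩ := h01 t ht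
    rw [e2, e4, hsimple hs' ht' (by rw [← e1, ← e3, h])]
  let g : Icc (0 : ℝ) 1 → γ '' Icc 0 1 := fun t => ⟨γ t, mem_image_of_mem _ t.2⟩
  have hg : Continuous g := hγ.domRestrict.subtype_mk _
  have hgs : Function.Surjective g := by
    rintro ⟨_, t, ht, rfl⟩
    exact ⟨⟨t, ht⟩, rfl⟩
  have hq : IsQuotientMap g := hg.isClosedMap.isQuotientMap hg hgs
  choose τ hτ using hgs
  have hτv : ∀ t : Icc (0 : ℝ) 1, v (τ (g t)) = v t := fun t =>
    hwd _ (τ (g t)).2 _ t.2 (congrArg Subtype.val (hτ (g t)))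
  refine ⟨fun y => v (τ y), ?_, fun y => ?_⟩
  · rw [hq.continuous_iff]
    exact hv.domRestrict.congr fun t => (hτv t).symm
  · rw [← hP _ (τ y).2]
    exact congrArg P (congrArg Subtype.val (hτ y)).symm

variable [Fintype ι]

theorem trace_vecMulVec_mul (v w : ι → ℝ) :
    (vecMulVec v v * vecMulVec w w).trace = (v ⬝ᵥ w) ^ 2 := by
  rw [vecMulVec_mul_vecMulVec, trace_vecMulVec, dotProduct_smul, smul_eq_mul, sq]

/-- A lift of `P` can be projected to a lift of `Q` as long as the lines `P t` and `Q t` are never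
orthogonal: `v` is replaced by the normalized projection `Q v / √⟨v, Q v⟩`. -/
theorem HasLift.of_trace_ne_zero {P Q : X → Matrix ι ι ℝ} (hP : HasLift P) (hQ : Continuous Q)
    (hQl : ∀ t, IsLine (Q t)) (h : ∀ t, (P t * Q t).trace ≠ 0) : HasLift Q := by
  obtain ⟨v, hv, hPv⟩ := hP
  have key : ∀ t, ∃ w : ι → ℝ, Q t = vecMulVec w w ∧ Q t *ᵥ v t = (v t ⬝ᵥ w) • w ∧
      v t ⬝ᵥ Q t *ᵥ v t = (v t ⬝ᵥ w) ^ 2 ∧ v t ⬝ᵥ w ≠ 0 := by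
    intro t
    obtain ⟨w, -, hw⟩ := hQl t
    have e : Q t *ᵥ v t = (v t ⬝ᵥ w) • w := by
      rw [hw, vecMulVec_mulVec, dotProduct_comm]
      ext i
      simp [mul_comm]
    refine ⟨w, hw, e, ?_, ?_⟩
    · rw [e, dotProduct_smul, smul_eq_mul, sq]
    · intro h0
      apply h t
      rw [hPv, hw, trace_vecMulVec_mul, h0]
      simp
  have hQv : Continuous fun t => Q t *ᵥ v t := hQ.matrix_mulVec hv
  refine ⟨fun t => (√(v t ⬝ᵥ Q t *ᵥ v t))⁻¹ • (Q t *ᵥ v t), ?_, ?_⟩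
  · refine Continuous.smul (Continuous.inv₀ (Continuous.sqrt (hv.dotProduct hQv)) ?_) hQv
    intro t
    obtain ⟨w, -, -, e, h0⟩ := key t
    rw [e, Real.sqrt_sq_eq_abs]
    exact abs_ne_zero.2 h0
  · intro t
    obtain ⟨w, e1, e2, e3, h0⟩ := key t
    simp only [e3]
    simp only [e2]
    rw [e1, Real.sqrt_sq_eq_abs]
    ext i j
    simp only [vecMulVec_apply, Pi.smul_apply, smul_eq_mul]
    have : |v t ⬝ᵥ w|⁻¹ * |v t ⬝ᵥ w|⁻¹ * ((v t ⬝ᵥ w) * (v t ⬝ᵥ w)) = 1 := by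
      rw [← abs_mul_abs_self (v t ⬝ᵥ w)]
      field_simp
    linear_combination (-(w i * w j)) * this

/-- Homotopy invariance of the existence of a lift. -/
theorem HasLift.of_homotopy {J : Type*} [TopologicalSpace J] [PreconnectedSpace J]
    [CompactSpace X] {F : J → X → Matrix ι ι ℝ} (hF : Continuous fun z : J × X => F z.1 z.2)
    (hl : ∀ r t, IsLine (F r t)) {r r' : J} (h : HasLift (F r)) : HasLift (F r') := by
  refine PreconnectedSpace.induction₂' (fun r r' => HasLift (F r) → HasLift (F r')) ?_
    ⟨fun _ _ _ h1 h2 h => h2 (h1 h)⟩ r r' h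
  intro r
  have hs : ∀ r, Continuous (F r) := fun r => hF.comp (Continuous.prodMk_right r)
  have ev : ∀ᶠ s in 𝓝 r, ∀ t ∈ (univ : Set X), (F r t * F s t).trace ≠ 0 := by
    refine isCompact_univ.eventually_forall_of_forall_eventually fun t _ => ?_
    have hc : Continuous fun z : J × X => (F r z.2 * F z.1 z.2).trace :=
      (((hs r).comp continuous_snd).matrix_mul hF).matrix_trace
    refine hc.continuousAt.eventually_ne ?_
    obtain ⟨w, hw, e⟩ := hl r t
    simp only [e, trace_vecMulVec_mul]
    exact pow_ne_zero _ (dotProduct_self_eq_zero.not.2 hw)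
  filter_upwards [ev] with s hs'
  refine ⟨fun h => h.of_trace_ne_zero (hs s) (hl s) fun t => hs' t trivial,
    fun h => h.of_trace_ne_zero (hs r) (hl r) fun t => ?_⟩
  rw [trace_mul_comm]
  exact hs' t trivial

/-- A continuous family of lines over a path has a lift: contract the path to its initial point. -/
theorem hasLift_Icc {P : Icc (0 : ℝ) 1 → Matrix ι ι ℝ} (hP : Continuous P)
    (hl : ∀ t, IsLine (P t)) : HasLift P := by
  have h0 : HasLift (fun t : Icc (0 : ℝ) 1 => P ((0 : Icc (0 : ℝ) 1) * t)) := by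
    obtain ⟨w, -, hw⟩ := hl 0
    exact ⟨fun _ => w, continuous_const, fun t => by simp [hw]⟩
  have := HasLift.of_homotopy (F := fun r t : Icc (0 : ℝ) 1 => P (r * t))
    (hP.comp (continuous_fst.mul continuous_snd)) (fun r t => hl _) (r := 0) (r' := 1) h0
  simpa using this

/-! ### The region enclosed by a closed curve -/

theorem isOpen_inside {C : Set Plane} (hC : IsClosed C) : IsOpen (inside C) := by
  rw [isOpen_iff_mem_nhds]
  rintro y ⟨hy, hb⟩
  filter_upwards [hC.isOpen_compl.connectedComponentIn.mem_nhds
    (mem_connectedComponentIn hy)] with z hz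
  exact ⟨connectedComponentIn_subset _ _ hz, by rwa [← connectedComponentIn_eq hz]⟩

theorem isClosed_union_inside {C : Set Plane} (hC : IsClosed C) : IsClosed (C ∪ inside C) := by
  rw [← isOpen_compl_iff, isOpen_iff_mem_nhds]
  intro y hy
  simp only [mem_compl_iff, mem_union, not_or] at hy
  filter_upwards [hC.isOpen_compl.connectedComponentIn.mem_nhds
    (mem_connectedComponentIn hy.1)] with z hz
  rintro (h | h)
  · exact connectedComponentIn_subset _ _ hz h
  · exact hy.2 ⟨hy.1, by rw [connectedComponentIn_eq hz]; exact h.2⟩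

/-- Points far away are not enclosed: the radial ray through such a point avoids the curve. -/
theorem notMem_inside_of_lt_dist {C : Set Plane} {x y : Plane} {ρ : ℝ} (hρ : 0 ≤ ρ)
    (hC : C ⊆ Metric.closedBall x ρ) (hy : ρ < dist y x) : y ∉ inside C := by
  rintro ⟨hyC, hb⟩
  have hd : 0 < ‖y - x‖ := by rw [← dist_eq_norm]; linarith
  have hdist : ∀ s : ℝ, 0 ≤ s → dist (x + s • (y - x)) x = s * ‖y - x‖ := by
    intro s hs
    rw [dist_eq_norm, add_sub_cancel_left, norm_smul, Real.norm_of_nonneg hs]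
  have hsub : (fun s : ℝ => x + s • (y - x)) '' Ici 1 ⊆ connectedComponentIn Cᶜ y := by
    refine IsPreconnected.subset_connectedComponentIn
      (isPreconnected_Ici.image _ (by fun_prop)) ⟨1, by simp, by simp⟩ ?_
    rintro _ ⟨s, hs, rfl⟩ h
    have h1 : 1 ≤ s := hs
    have := hC h
    rw [Metric.mem_closedBall, hdist s (by linarith)] at this
    rw [dist_eq_norm] at hy
    nlinarith
  obtain ⟨R, hR⟩ := (Metric.isBounded_iff_subset_closedBall x).1 (hb.subset hsub)
  have h1 : (1 : ℝ) ≤ max 1 ((R + 1) / ‖y - x‖) := le_max_left _ _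
  have := hR ⟨max 1 ((R + 1) / ‖y - x‖), h1, rfl⟩
  rw [Metric.mem_closedBall, hdist _ (by linarith)] at this
  have h2 : (R + 1) / ‖y - x‖ * ‖y - x‖ ≤ max 1 ((R + 1) / ‖y - x‖) * ‖y - x‖ := by
    gcongr
    exact le_max_right _ _
  rw [div_mul_cancel₀ _ hd.ne'] at h2
  linarith

/-! ### Transport of lifts from a closed curve to small circles around an enclosed point -/

/-- If a family of lines on a closed curve `C` and its enclosed region, punctured at `x`, has a
lift over `C`, then it has a lift over every small circle around `x`.

The lift over `C` allows to continue the family by a family with a lift to the complement of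
the enclosed region. Far away from `C` this continuation is all there is, so the resulting family
on `ℝ² \ {x}` has a lift over a large circle, hence over every circle around `x`. -/
theorem hasLift_sphere_of_hasLift_curve {C : Set Plane} (hC : IsCompact C) {x : Plane}
    (hx : x ∈ inside C) {P : Plane → Matrix ι ι ℝ}
    (hP : ContinuousOn P ((C ∪ inside C) \ {x})) (hl : ∀ y ∈ (C ∪ inside C) \ {x}, IsLine (P y))
    (hlift : HasLift (fun y : C => P y)) :
    ∃ ρ > (0 : ℝ), ∀ r : ℝ, 0 < r → r < ρ →
      HasLift (fun e : Metric.sphere (0 : Plane) 1 => P (x + r • (e : Plane))) := by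
  classical
  rcases C.eq_empty_or_nonempty with rfl | hne
  · exact absurd hx.2 (by simpa [connectedComponentIn_univ] using
      (NormedSpace.unbounded_univ ℝ Plane))
  obtain ⟨V, hV, hPV⟩ := hlift
  obtain ⟨W, hW⟩ := ContinuousMap.exists_restrict_eq hC.isClosed ⟨V, hV⟩
  have hWV : ∀ y : C, W y = V y := fun y => congrArg (fun f => f y) hW
  -- The additional coordinate keeps the extended vector away from zero off the curve.
  let V' : Plane → ι ⊕ Unit → ℝ := fun y => Sum.elim (W y) (fun _ => Metric.infDist y C)
  have hV' : Continuous V' := by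
    refine continuous_pi fun i => ?_
    rcases i with i | i
    · exact (continuous_apply i).comp W.continuous
    · exact Metric.continuous_infDist_pt C
  have hV'0 : ∀ y, y ∉ inside C → V' y ≠ 0 := by
    intro y hy h0
    have hyC : y ∈ C := by
      rw [hC.isClosed.mem_iff_infDist_zero hne]
      exact congrFun h0 (Sum.inr ())
    obtain ⟨w, hw, e⟩ := hl y ⟨Or.inl hyC, fun h => hx.1 (by rw [← mem_singleton_iff.1 h]; exact hyC)⟩
    have hV0 : V ⟨y, hyC⟩ = 0 := by
      rw [← hWV]
      ext i
      exact congrFun h0 (Sum.inl i)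
    apply hw
    have h2 := hPV ⟨y, hyC⟩
    simp only [hV0, e] at h2
    rcases eq_or_eq_neg_of_vecMulVec_eq h2 with h | h <;> simpa using h
  let Pin : Plane → Matrix (ι ⊕ Unit) (ι ⊕ Unit) ℝ := fun y => fromBlocks (P y) 0 0 0
  let P' : Plane → Matrix (ι ⊕ Unit) (ι ⊕ Unit) ℝ := fun y =>
    if y ∈ inside C then Pin y else vecMulVec (V' y) (V' y)
  have hPin : ContinuousOn P' ((C ∪ inside C) \ {x}) := by
    have : ContinuousOn Pin ((C ∪ inside C) \ {x}) := by
      rw [continuousOn_iff_continuous_domRestrict] at hP ⊢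
      exact Continuous.matrix_fromBlocks hP continuous_const continuous_const continuous_const
    refine this.congr fun y hy => ?_
    by_cases h : y ∈ inside C
    · simp [P', h]
    · have hyC : y ∈ C := hy.1.resolve_right h
      simp only [P', h, if_false, Pin, V']
      have e : P y = _ := hPV ⟨y, hyC⟩
      rw [e, ← hWV, Metric.infDist_zero_of_mem hyC]
      ext (i | i) (j | j) <;> simp [vecMulVec_apply]
  have hPo : ContinuousOn P' ((inside C)ᶜ \ {x}) := by
    have : Continuous fun y => vecMulVec (V' y) (V' y) := hV'.matrix_vecMulVec hV'
    refine this.continuousOn.congr fun y hy => ?_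
    have : y ∉ inside C := hy.1
    simp [P', this]
  have hP' : ContinuousOn P' {x}ᶜ := by
    intro y hy
    have h1 : ContinuousWithinAt P' ((C ∪ inside C) \ {x} ∪ (inside C)ᶜ \ {x}) y := by
      by_cases h : y ∈ C ∪ inside C
      · by_cases h' : y ∈ inside C
        · have := (hPin y ⟨h, hy⟩).mono_of_mem_nhdsWithin (s := univ) (by
            rw [nhdsWithin_univ]
            filter_upwards [(isOpen_inside hC.isClosed).mem_nhds h',
              isOpen_compl_singleton.mem_nhds hy] with z hz hz'
            exact ⟨Or.inr hz, hz'⟩)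
          exact this.mono (subset_univ _)
        · exact (hPin y ⟨h, hy⟩).union (hPo y ⟨h', hy⟩)
      · have := (hPo y ⟨fun h' => h (Or.inr h'), hy⟩).mono_of_mem_nhdsWithin (s := univ) (by
            rw [nhdsWithin_univ]
            filter_upwards [(isClosed_union_inside hC.isClosed).isOpen_compl.mem_nhds h,
              isOpen_compl_singleton.mem_nhds hy] with z hz hz'
            exact ⟨fun h' => hz (Or.inr h'), hz'⟩)
        exact this.mono (subset_univ _)
    refine h1.mono fun z hz => ?_
    by_cases h : z ∈ inside C
    · exact Or.inl ⟨Or.inr h, hz⟩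
    · exact Or.inr ⟨h, hz⟩
  have hl' : ∀ y ≠ x, IsLine (P' y) := by
    intro y hy
    by_cases h : y ∈ inside C
    · obtain ⟨w, hw, e⟩ := hl y ⟨Or.inr h, hy⟩
      refine ⟨Sum.elim w 0, fun h0 => hw ?_, ?_⟩
      · ext i
        exact congrFun h0 (Sum.inl i)
      · simp only [P', h, if_true, Pin, e]
        ext (i | i) (j | j) <;> simp [vecMulVec_apply]
    · simp only [P', h, if_false]
      exact isLine_vecMulVec (hV'0 y h)
  have hne' : ∀ (r : Ioi (0 : ℝ)) (e : Metric.sphere (0 : Plane) 1),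
      x + (r : ℝ) • (e : Plane) ≠ x := by
    intro r e h
    have he : ‖(e : Plane)‖ = 1 := by simp
    have hr : (0 : ℝ) < r := r.2
    rw [add_eq_left, smul_eq_zero] at h
    rcases h with h | h
    · exact hr.ne' h
    · rw [h] at he; simp at he
  have hF : Continuous fun z : Ioi (0 : ℝ) × Metric.sphere (0 : Plane) 1 =>
      P' (x + (z.1 : ℝ) • (z.2 : Plane)) := by
    refine hP'.comp_continuous (by fun_prop) fun z => hne' z.1 z.2
  have : PreconnectedSpace (Ioi (0 : ℝ)) := Subtype.preconnectedSpace isPreconnected_Ioi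
  obtain ⟨ρ', hρ'⟩ := (Metric.isBounded_iff_subset_closedBall x).1 hC.isBounded
  have hbig : ∀ e : Metric.sphere (0 : Plane) 1,
      x + (|ρ'| + 1) • (e : Plane) ∉ inside C := by
    intro e
    have he : ‖(e : Plane)‖ = 1 := by simp
    refine notMem_inside_of_lt_dist (abs_nonneg ρ')
      (hρ'.trans (Metric.closedBall_subset_closedBall (le_abs_self _))) ?_
    rw [dist_eq_norm, add_sub_cancel_left, norm_smul, he, Real.norm_of_nonneg (by positivity)]
    linarith
  have hlarge : HasLift (fun e : Metric.sphere (0 : Plane) 1 =>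
      P' (x + (|ρ'| + 1) • (e : Plane))) := by
    refine ⟨fun e => V' (x + (|ρ'| + 1) • (e : Plane)), hV'.comp (by fun_prop), fun e => ?_⟩
    simp [P', hbig e]
  obtain ⟨ρ, hρ, hball⟩ := Metric.isOpen_iff.1 (isOpen_inside hC.isClosed) x hx
  refine ⟨ρ, hρ, fun r hr hrρ => ?_⟩
  obtain ⟨v, hv, hv'⟩ := HasLift.of_homotopy
    (F := fun (r : Ioi (0 : ℝ)) (e : Metric.sphere (0 : Plane) 1) => P' (x + (r : ℝ) • (e : Plane)))
    hF (fun r e => hl' _ (hne' r e)) (r := ⟨|ρ'| + 1, by simp; positivity⟩) (r' := ⟨r, hr⟩) hlarge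
  refine ⟨fun e i => v e (Sum.inl i), by fun_prop, fun e => ?_⟩
  have he : ‖(e : Plane)‖ = 1 := by simp
  have hin : x + r • (e : Plane) ∈ inside C := by
    apply hball
    rw [Metric.mem_ball, dist_eq_norm, add_sub_cancel_left, norm_smul, he,
      Real.norm_of_nonneg hr.le]
    linarith
  have h2 := hv' e
  simp only [P', hin, if_true, Pin] at h2
  ext i j
  have := congrFun (congrFun h2 (Sum.inl i)) (Sum.inl j)
  simpa [vecMulVec_apply] using this

theorem one_lt_rank_plane : 1 < Module.rank ℝ Plane := by
  rw [← Module.finrank_eq_rank, finrank_euclideanSpace_fin]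
  norm_num

/-- Antipodal criterion for the absence of a lift over a closed curve `C`. For an enclosed point `x`,
suppose that for small `h ≠ 0` the lines at `x + h` and `x - h` are linearly independent, in the
sense that a skew form `α ∧ β` does not vanish on them. Over a small circle around `x`, a lift `v`
would make `(α ∧ β) (v (x + h), v (x - h))` an odd function without zeros on a circle. -/
theorem not_hasLift_of_antipodal {C : Set Plane} (hC : IsCompact C) {x : Plane}
    (hx : x ∈ inside C) {P : Plane → Matrix ι ι ℝ}
    (hP : ContinuousOn P ((C ∪ inside C) \ {x})) (hl : ∀ y ∈ (C ∪ inside C) \ {x}, IsLine (P y))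
    {α β : (ι → ℝ) → ℝ} (hα : Continuous α) (hβ : Continuous β)
    (hαβ : ∀ᶠ h in 𝓝[≠] (0 : Plane), ∀ v v' : ι → ℝ, P (x + h) = vecMulVec v v →
      P (x - h) = vecMulVec v' v' → α v * β v' ≠ β v * α v') :
    ¬ HasLift (fun y : C => P y) := by
  intro hlift
  obtain ⟨ρ, hρ, H⟩ := hasLift_sphere_of_hasLift_curve hC hx hP hl hlift
  obtain ⟨ε, hε, hball⟩ := Metric.mem_nhdsWithin_iff.1 hαβ
  set r := min (ρ / 2) (ε / 2) with hr
  have hr0 : 0 < r := by positivity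
  have hr1 : r < ρ := (min_le_left _ _).trans_lt (by linarith)
  have hr2 : r < ε := (min_le_right _ _).trans_lt (by linarith)
  obtain ⟨v, hv, hPv⟩ := H r hr0 hr1
  let f : Metric.sphere (0 : Plane) 1 → ℝ := fun e => α (v e) * β (v (-e)) - β (v e) * α (v (-e))
  have hf : Continuous f := by fun_prop
  have hodd : ∀ e, f (-e) = - f e := fun e => by simp only [f, neg_neg]; ring
  have hf0 : ∀ e, f e ≠ 0 := by
    intro e
    have he : ‖(e : Plane)‖ = 1 := by simp
    refine sub_ne_zero.2 (hball (a := r • (e : Plane)) ⟨?_, ?_⟩ (v e) (v (-e)) (hPv e) ?_)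
    · rw [mem_ball_zero_iff, norm_smul, he, Real.norm_of_nonneg hr0.le]
      linarith
    · rw [mem_compl_iff, mem_singleton_iff, smul_eq_zero, not_or]
      refine ⟨hr0.ne', fun h => ?_⟩
      rw [h] at he; simp at he
    · have := hPv (-e)
      simpa [sub_eq_add_neg] using this
  have : ConnectedSpace (Metric.sphere (0 : Plane) 1) :=
    isConnected_iff_connectedSpace.1 (isConnected_sphere one_lt_rank_plane 0 zero_le_one)
  obtain ⟨e⟩ : Nonempty (Metric.sphere (0 : Plane) 1) := inferInstance
  have : (0 : ℝ) ∈ range f := by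
    rcases le_total (f e) 0 with h | h
    · exact mem_range_of_exists_le_of_exists_ge hf ⟨e, h⟩ ⟨-e, by rw [hodd]; linarith⟩
    · exact mem_range_of_exists_le_of_exists_ge hf ⟨-e, by rw [hodd]; linarith⟩ ⟨e, h⟩
  obtain ⟨e, he⟩ := this
  exact hf0 e he

/-! ### Ordered eigenvalues and eigenvectors of real symmetric matrices -/

section Spectral

variable {m : Type*} [Fintype m]

theorem dotProduct_eigenvectors_eq_zero {M : Matrix m m ℝ} (hM : M.IsSymm) {v w : m → ℝ} {a b : ℝ}
    (hv : M *ᵥ v = a • v) (hw : M *ᵥ w = b • w) (hab : a ≠ b) : v ⬝ᵥ w = 0 := by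
  have h1 : v ⬝ᵥ M *ᵥ w = b * (v ⬝ᵥ w) := by rw [hw, dotProduct_smul, smul_eq_mul]
  have h2 : v ⬝ᵥ M *ᵥ w = a * (v ⬝ᵥ w) := by
    rw [dotProduct_mulVec, ← mulVec_transpose, hM.eq, hv, smul_dotProduct, smul_eq_mul]
  have : (a - b) * (v ⬝ᵥ w) = 0 := by rw [sub_mul, ← h1, ← h2, sub_self]
  exact (mul_eq_zero.1 this).resolve_left (sub_ne_zero.2 hab)

theorem isLine_of_dotProduct_self {v : m → ℝ} (h : v ⬝ᵥ v = 1) : IsLine (vecMulVec v v) :=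
  isLine_vecMulVec fun h0 => by simp [h0] at h

theorem isCompact_unitVectors : IsCompact {v : m → ℝ | v ⬝ᵥ v = 1} := by
  refine (isCompact_univ_pi fun _ : m => isCompact_Icc (a := (-1 : ℝ)) (b := 1)).of_isClosed_subset
    (isClosed_eq (by fun_prop) continuous_const) ?_
  intro v hv a _
  have h1 : v a * v a ≤ v ⬝ᵥ v :=
    Finset.single_le_sum (f := fun a => v a * v a) (fun a _ => mul_self_nonneg _) (Finset.mem_univ a)
  rw [show v ⬝ᵥ v = 1 from hv] at h1
  constructor <;> nlinarith

/-- Unit vectors have a limit along an ultrafilter. -/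
theorem exists_tendsto_unitVectors {Y : Type*} (G : Ultrafilter Y) {v : Y → m → ℝ}
    (hv : ∀ᶠ y in (G : Filter Y), v y ⬝ᵥ v y = 1) :
    ∃ a : m → ℝ, a ⬝ᵥ a = 1 ∧ Tendsto v G (𝓝 a) := by
  obtain ⟨a, ha, h⟩ := isCompact_unitVectors.ultrafilter_le_nhds (G.map v)
    (by rw [le_principal_iff]; exact hv)
  exact ⟨a, ha, h⟩

variable [DecidableEq m]

theorem orderedEigenvalue_eq_of_charpoly {N : ℕ} {M : Matrix m m ℝ} {μ : Fin N → ℝ}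
    (hμ : Antitone μ) (h : M.charpoly = ∏ i, (Polynomial.X - Polynomial.C (μ i))) (i : Fin N) :
    orderedEigenvalue M i = μ i := by
  have hr : M.charpoly.roots = Multiset.map μ Finset.univ.val := by
    rw [h, Polynomial.roots_prod]
    · simp
    · simp [Finset.prod_ne_zero_iff, Polynomial.X_sub_C_ne_zero]
  have hs : M.charpoly.roots.sort (· ≥ ·) = List.ofFn μ := by
    rw [hr, Fin.univ_val_map, Multiset.coe_sort]
    apply List.mergeSort_of_pairwise
    simp_rw [decide_eq_true_eq, ← List.sortedGE_iff_pairwise]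
    exact hμ.sortedGE_ofFn
  rw [orderedEigenvalue, hs, List.getD_eq_getElem _ _ (by simp)]
  simp

/-- An orthonormal basis of eigenvectors of `M`, the `i`-th one for the `i`-th largest eigenvalue. -/
structure IsOrderedEigenbasis (M : Matrix m m ℝ) (f : Fin (Fintype.card m) → m → ℝ) : Prop where
  orthonormal : ∀ i j, f i ⬝ᵥ f j = if i = j then 1 else 0
  mulVec : ∀ i, M *ᵥ f i = orderedEigenvalue M i • f i

theorem mul_transpose_eq_one_of_orthonormal {f : Fin (Fintype.card m) → m → ℝ}
    (hf : ∀ i j, f i ⬝ᵥ f j = if i = j then 1 else 0) : (of f)ᵀ * of f = 1 := by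
  have h : of f * (of f)ᵀ = 1 := by
    ext i j
    rw [mul_apply_eq_vecMul]
    simpa [one_apply, vecMul, dotProduct] using hf i j
  exact (mul_eq_one_comm_of_card_eq _ _ _ (by simp)).1 h

theorem eq_sum_of_orthonormal {f : Fin (Fintype.card m) → m → ℝ}
    (hf : ∀ i j, f i ⬝ᵥ f j = if i = j then 1 else 0) (z : m → ℝ) :
    z = ∑ i, (f i ⬝ᵥ z) • f i := by
  have h := mul_transpose_eq_one_of_orthonormal hf
  conv_lhs => rw [← one_mulVec z, ← h, ← mulVec_mulVec]
  ext a
  simp [mulVec, dotProduct, mul_comm]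

/-- Orthonormal eigenvectors, listed by decreasing eigenvalues, compute the ordered eigenvalues. -/
theorem orderedEigenvalue_eq_of_orthonormal {M : Matrix m m ℝ}
    {f : Fin (Fintype.card m) → m → ℝ} {μ : Fin (Fintype.card m) → ℝ} (hμ : Antitone μ)
    (hf : ∀ i j, f i ⬝ᵥ f j = if i = j then 1 else 0) (hM : ∀ i, M *ᵥ f i = μ i • f i)
    (i : Fin (Fintype.card m)) : orderedEigenvalue M i = μ i := by
  refine orderedEigenvalue_eq_of_charpoly hμ ?_ i
  have h1 := mul_transpose_eq_one_of_orthonormal hf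
  have h2 : of f * (of f)ᵀ = 1 := (mul_eq_one_comm_of_card_eq _ _ _ (by simp)).1 h1
  have h3 : M * (of f)ᵀ = (of f)ᵀ * diagonal μ := by
    ext a j
    have := congrFun (hM j) a
    rw [mul_diagonal]
    simpa [mul_apply, mulVec, dotProduct, mul_comm] using this
  have h4 : M = ((of f)ᵀ * diagonal μ) * of f := by
    rw [← h3, Matrix.mul_assoc, h1, Matrix.mul_one]
  have h5 := charpoly_mul_comm' ((of f)ᵀ * diagonal μ) (of f)
  rw [← h4, ← Matrix.mul_assoc, h2, Matrix.one_mul, Fintype.card_fin] at h5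
  rw [← charpoly_diagonal]
  exact mul_left_cancel₀ (pow_ne_zero _ Polynomial.X_ne_zero) h5

theorem exists_isOrderedEigenbasis {M : Matrix m m ℝ} (hM : M.IsSymm) :
    ∃ f, IsOrderedEigenbasis M f := by
  have hH : M.IsHermitian := by
    rw [IsHermitian, conjTranspose_eq_transpose_of_trivial]
    exact hM
  let e : Fin (Fintype.card m) ≃ m := Fintype.equivOfCardEq (Fintype.card_fin _)
  have hev : ∀ i : Fin (Fintype.card m), orderedEigenvalue M i = hH.eigenvalues₀ i := by
    intro i
    have h := hH.sort_roots_charpoly_eq_eigenvalues₀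
    have h' : M.charpoly.roots.sort (· ≥ ·) = List.ofFn hH.eigenvalues₀ := by
      rw [← h]
      simp
    rw [orderedEigenvalue, h', List.getD_eq_getElem _ _ (by simp)]
    simp
  refine ⟨fun i => (hH.eigenvectorBasis (e i)).ofLp, fun i j => ?_, fun i => ?_⟩
  · have := orthonormal_iff_ite.1 hH.eigenvectorBasis.orthonormal (e j) (e i)
    rw [EuclideanSpace.inner_eq_star_dotProduct] at this
    simpa [eq_comm] using this
  · rw [hH.mulVec_eigenvectorBasis, hev]
    congr 1
    simp [IsHermitian.eigenvalues, e]

/-- The `i`-th ordered eigenvalue is simple. -/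
def IsSimple (M : Matrix m m ℝ) (i : ℕ) : Prop :=
  ∀ j < Fintype.card m, j ≠ i → orderedEigenvalue M j ≠ orderedEigenvalue M i

/-- Eigenvectors for a simple eigenvalue are proportional. -/
theorem IsOrderedEigenbasis.eq_smul {M : Matrix m m ℝ} (hM : M.IsSymm)
    {f : Fin (Fintype.card m) → m → ℝ} (hf : IsOrderedEigenbasis M f) {i : Fin (Fintype.card m)}
    (hi : IsSimple M i) {v : m → ℝ} (hv : M *ᵥ v = orderedEigenvalue M i • v) :
    v = (f i ⬝ᵥ v) • f i := by
  conv_lhs => rw [eq_sum_of_orthonormal hf.orthonormal v]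
  refine Finset.sum_eq_single i (fun j _ hj => ?_) (by simp)
  rw [dotProduct_eigenvectors_eq_zero hM (hf.mulVec j) hv
    (hi j j.2 (fun h => hj (Fin.ext h))), zero_smul]

theorem vecMulVec_eq_of_isSimple {M : Matrix m m ℝ} (hM : M.IsSymm) {i : ℕ}
    (hi : i < Fintype.card m) (hs : IsSimple M i) {v w : m → ℝ}
    (hv : M *ᵥ v = orderedEigenvalue M i • v) (hv1 : v ⬝ᵥ v = 1)
    (hw : M *ᵥ w = orderedEigenvalue M i • w) (hw1 : w ⬝ᵥ w = 1) :
    vecMulVec v v = vecMulVec w w := by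
  obtain ⟨f, hf⟩ := exists_isOrderedEigenbasis hM
  have h1 := hf.eq_smul hM (i := ⟨i, hi⟩) hs hv
  have h2 := hf.eq_smul hM (i := ⟨i, hi⟩) hs hw
  generalize f ⟨i, hi⟩ ⬝ᵥ v = a at h1
  generalize f ⟨i, hi⟩ ⬝ᵥ w = b at h2
  have hff : f ⟨i, hi⟩ ⬝ᵥ f ⟨i, hi⟩ = 1 := by simp [hf.orthonormal]
  rw [h1, smul_dotProduct, dotProduct_smul, hff] at hv1
  rw [h2, smul_dotProduct, dotProduct_smul, hff] at hw1
  simp only [smul_eq_mul, mul_one] at hv1 hw1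
  rw [h1, h2]
  ext x y
  simp only [vecMulVec_apply, Pi.smul_apply, smul_eq_mul]
  linear_combination (f ⟨i, hi⟩ x * f ⟨i, hi⟩ y) * (hv1 - hw1)

open Classical in
/-- The eigenline of the `i`-th ordered eigenvalue, as the projection matrix `f fᵀ` for a unit
eigenvector `f`. It depends on a choice, unless the eigenvalue is simple. The matrix has to be
symmetric and `i` less than its size; otherwise the value is `0`. -/
noncomputable def eigenline (M : Matrix m m ℝ) (i : ℕ) : Matrix m m ℝ :=
  if h : M.IsSymm ∧ i < Fintype.card m then
    vecMulVec ((exists_isOrderedEigenbasis h.1).choose ⟨i, h.2⟩)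
      ((exists_isOrderedEigenbasis h.1).choose ⟨i, h.2⟩)
  else 0

theorem eigenline_eq {M : Matrix m m ℝ} (hM : M.IsSymm) {i : ℕ}
    (hi : i < Fintype.card m) (hs : IsSimple M i) {v : m → ℝ}
    (hv : M *ᵥ v = orderedEigenvalue M i • v) (hv1 : v ⬝ᵥ v = 1) :
    eigenline M i = vecMulVec v v := by
  rw [eigenline, dif_pos ⟨hM, hi⟩]
  have hf := (exists_isOrderedEigenbasis hM).choose_spec
  exact vecMulVec_eq_of_isSimple hM hi hs (hf.mulVec ⟨i, hi⟩) (by simp [hf.orthonormal]) hv hv1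

theorem exists_eigenline_eq {M : Matrix m m ℝ} (hM : M.IsSymm) {i : ℕ} (hi : i < Fintype.card m) :
    ∃ v, eigenline M i = vecMulVec v v ∧ M *ᵥ v = orderedEigenvalue M i • v ∧ v ⬝ᵥ v = 1 := by
  have hf := (exists_isOrderedEigenbasis hM).choose_spec
  refine ⟨_, ?_, hf.mulVec ⟨i, hi⟩, by simp [hf.orthonormal]⟩
  rw [eigenline, dif_pos ⟨hM, hi⟩]

theorem isLine_eigenline {M : Matrix m m ℝ} (hM : M.IsSymm) {i : ℕ} (hi : i < Fintype.card m) :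
    IsLine (eigenline M i) := by
  obtain ⟨v, e, -, h⟩ := exists_eigenline_eq hM hi
  exact e ▸ isLine_of_dotProduct_self h

/-- A vector spanning the eigenline is a unit eigenvector. -/
theorem eigenvector_of_eigenline_eq {M : Matrix m m ℝ} (hM : M.IsSymm) {i : ℕ}
    (hi : i < Fintype.card m) {v : m → ℝ} (h : eigenline M i = vecMulVec v v) :
    M *ᵥ v = orderedEigenvalue M i • v ∧ v ⬝ᵥ v = 1 := by
  obtain ⟨w, e, hw, hw1⟩ := exists_eigenline_eq hM hi
  rcases eq_or_eq_neg_of_vecMulVec_eq (h.symm.trans e) with rfl | rfl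
  · exact ⟨hw, hw1⟩
  · exact ⟨by rw [mulVec_neg, hw, smul_neg], by simpa using hw1⟩

theorem antitone_orderedEigenvalue {M : Matrix m m ℝ} {i j : ℕ} (hM : M.IsSymm) (hij : i ≤ j)
    (hj : j < Fintype.card m) : orderedEigenvalue M j ≤ orderedEigenvalue M i := by
  have hH : M.IsHermitian := by
    rw [IsHermitian, conjTranspose_eq_transpose_of_trivial]
    exact hM
  have hc : M.charpoly = ∏ i, (Polynomial.X - Polynomial.C (hH.eigenvalues₀ i)) := by
    rw [hH.charpoly_eq]
    exact Fintype.prod_equiv (Fintype.equivOfCardEq (Fintype.card_fin _)).symm _ _ fun i => rfl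
  rw [orderedEigenvalue_eq_of_charpoly hH.eigenvalues₀_antitone hc ⟨j, hj⟩,
    orderedEigenvalue_eq_of_charpoly hH.eigenvalues₀_antitone hc ⟨i, hij.trans_lt hj⟩]
  exact hH.eigenvalues₀_antitone hij

/-- The eigenline of a simple eigenvalue depends continuously on the symmetric matrix: limits of
ordered eigenbases, taken along ultrafilters, are ordered eigenbases. -/
theorem continuousWithinAt_eigenline {M₀ : Matrix m m ℝ} (hM : M₀.IsSymm) {i : ℕ}
    (hi : i < Fintype.card m) (hs : IsSimple M₀ i) :
    ContinuousWithinAt (fun M => eigenline M i) {M : Matrix m m ℝ | M.IsSymm} M₀ := by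
  rw [ContinuousWithinAt, tendsto_iff_ultrafilter]
  intro G hG
  have hid : Tendsto (fun M => M) (G : Filter (Matrix m m ℝ)) (𝓝 M₀) :=
    hG.trans nhdsWithin_le_nhds
  have hsym : ∀ᶠ M in (G : Filter (Matrix m m ℝ)), M.IsSymm := hG self_mem_nhdsWithin
  have hf : ∀ M : Matrix m m ℝ, ∃ f : Fin (Fintype.card m) → m → ℝ, M.IsSymm →
      IsOrderedEigenbasis M f ∧ eigenline M i = vecMulVec (f ⟨i, hi⟩) (f ⟨i, hi⟩) := by
    intro M
    by_cases h : M.IsSymm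
    · refine ⟨_, fun _ => ⟨(exists_isOrderedEigenbasis h).choose_spec, ?_⟩⟩
      rw [eigenline, dif_pos ⟨h, hi⟩]
    · exact ⟨0, fun h' => absurd h' h⟩
  choose f hf using hf
  have hlim : ∀ j, ∃ a : m → ℝ, a ⬝ᵥ a = 1 ∧ Tendsto (fun M => f M j) G (𝓝 a) := by
    intro j
    refine exists_tendsto_unitVectors G ?_
    filter_upwards [hsym] with M h
    simp [(hf M h).1.orthonormal]
  choose a ha1 ha using hlim
  have hμ : ∀ j : Fin (Fintype.card m), Tendsto (fun M => orderedEigenvalue M j) (G : Filter (Matrix m m ℝ))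
      (𝓝 (a j ⬝ᵥ M₀ *ᵥ a j)) := by
    intro j
    have hc : Continuous fun p : Matrix m m ℝ × (m → ℝ) => p.2 ⬝ᵥ p.1 *ᵥ p.2 := by fun_prop
    refine ((hc.tendsto (M₀, a j)).comp (hid.prodMk_nhds (ha j))).congr' ?_
    filter_upwards [hsym] with M h
    simp [(hf M h).1.mulVec, (hf M h).1.orthonormal]
  have hort : ∀ j k, a j ⬝ᵥ a k = if j = k then 1 else 0 := by
    intro j k
    have hc : Continuous fun p : (m → ℝ) × (m → ℝ) => p.1 ⬝ᵥ p.2 := by fun_prop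
    refine tendsto_nhds_unique ((hc.tendsto (a j, a k)).comp ((ha j).prodMk_nhds (ha k))) ?_
    refine tendsto_const_nhds.congr' ?_
    filter_upwards [hsym] with M h
    simp [(hf M h).1.orthonormal]
  have heig : ∀ j, M₀ *ᵥ a j = (a j ⬝ᵥ M₀ *ᵥ a j) • a j := by
    intro j
    have hc : Continuous fun p : Matrix m m ℝ × (m → ℝ) => p.1 *ᵥ p.2 := by fun_prop
    refine tendsto_nhds_unique ((hc.tendsto (M₀, a j)).comp (hid.prodMk_nhds (ha j))) ?_
    refine ((hμ j).smul (ha j)).congr' ?_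
    filter_upwards [hsym] with M h
    simp [(hf M h).1.mulVec]
  have hanti : Antitone fun j => a j ⬝ᵥ M₀ *ᵥ a j := by
    intro j k hjk
    refine le_of_tendsto_of_tendsto (hμ k) (hμ j) ?_
    filter_upwards [hsym] with M h
    exact antitone_orderedEigenvalue h hjk k.2
  have hlam := orderedEigenvalue_eq_of_orthonormal hanti hort heig ⟨i, hi⟩
  rw [eigenline_eq hM hi hs (v := a ⟨i, hi⟩) (by rw [heig, ← hlam]) (ha1 _)]
  have hc : Continuous fun v : m → ℝ => vecMulVec v v := continuous_id.matrix_vecMulVec continuous_id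
  refine ((hc.tendsto (a ⟨i, hi⟩)).comp (ha ⟨i, hi⟩)).congr' ?_
  filter_upwards [hsym] with M h
  exact (hf M h).2.symm

theorem continuousOn_eigenline {Y : Type*} [TopologicalSpace Y] {M : Y → Matrix m m ℝ} {s : Set Y}
    (hMc : ContinuousOn M s) (hM : ∀ y ∈ s, (M y).IsSymm) {i : ℕ} (hi : i < Fintype.card m)
    (hs : ∀ y ∈ s, IsSimple (M y) i) : ContinuousOn (fun y => eigenline (M y) i) s := by
  intro y hy
  have h := continuousWithinAt_eigenline (hM y hy) hi (hs y hy)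
  exact Tendsto.comp h (tendsto_nhdsWithin_iff.2
    ⟨hMc y hy, eventually_nhdsWithin_of_forall fun z hz => hM z hz⟩)

end Spectral

/-! ### Singular values of complex symmetric matrices -/

section SingularValues

variable {n : ℕ}

theorem isSymm_realForm {A : Matrix (Fin n) (Fin n) ℂ} (hA : Aᵀ = A) : (realForm A).IsSymm := by
  have h : ∀ i j, A i j = A j i := fun i j => congrFun (congrFun hA.symm i) j
  ext (i | i) (j | j) <;> simp [realForm, h i j]

/-- In the coordinates `u = p + iq` and its conjugate, `realForm A` becomes the matrix with blocks
`A` and the conjugate of `A` off the diagonal, whose characteristic polynomial is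
`det (X ^ 2 - A Aᴴ)` for symmetric `A`. -/
theorem charpoly_realForm {A : Matrix (Fin n) (Fin n) ℂ} (hA : Aᵀ = A) {a : Fin n → ℝ}
    (h : (A * Aᴴ).charpoly = ∏ i, (Polynomial.X - Polynomial.C ((a i : ℂ) ^ 2))) :
    (realForm A).charpoly =
      ∏ i, ((Polynomial.X - Polynomial.C (a i)) * (Polynomial.X - Polynomial.C (-a i))) := by
  apply Polynomial.map_injective Complex.ofRealHom Complex.ofReal_injective
  rw [← charpoly_map]
  have hAc : Aᴴ = A.map star := by rw [conjTranspose, hA]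
  let T : Matrix (Fin n ⊕ Fin n) (Fin n ⊕ Fin n) ℂ :=
    fromBlocks 1 (Complex.I • 1) 1 (-Complex.I • 1)
  let T' : Matrix (Fin n ⊕ Fin n) (Fin n ⊕ Fin n) ℂ :=
    fromBlocks ((1 / 2 : ℂ) • 1) ((1 / 2 : ℂ) • 1) ((-Complex.I / 2) • 1) ((Complex.I / 2) • 1)
  have hTT : T * T' = 1 := by
    have hI : Complex.I * Complex.I = -1 := Complex.I_mul_I
    have h1 : (1 / 2 : ℂ) + Complex.I * (-Complex.I / 2) = 1 := by linear_combination (-1 / 2) * hI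
    have h2 : (1 / 2 : ℂ) + Complex.I * (Complex.I / 2) = 0 := by linear_combination (1 / 2) * hI
    have h3 : (1 / 2 : ℂ) + -Complex.I * (-Complex.I / 2) = 0 := by
      linear_combination (1 / 2) * hI
    have h4 : (1 / 2 : ℂ) + -Complex.I * (Complex.I / 2) = 1 := by linear_combination (-1 / 2) * hI
    simp only [T, T', fromBlocks_multiply, Matrix.one_mul, smul_mul_smul_comm, ← add_smul, h1, h2,
      h3, h4, one_smul, zero_smul, fromBlocks_one]
  let N : Matrix (Fin n ⊕ Fin n) (Fin n ⊕ Fin n) ℂ := fromBlocks 0 A Aᴴ 0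
  have hTM : T * (realForm A).map Complex.ofRealHom = N * T := by
    simp only [T, N, realForm, fromBlocks_map, fromBlocks_multiply, hAc]
    congr 1 <;> ext i j <;> apply Complex.ext <;> simp
  have hM : (realForm A).map Complex.ofRealHom = T' * (N * T) := by
    rw [← hTM, ← Matrix.mul_assoc, mul_eq_one_comm.1 hTT, Matrix.one_mul]
  have hc : ((realForm A).map Complex.ofRealHom).charpoly = N.charpoly := by
    rw [hM, charpoly_mul_comm, Matrix.mul_assoc, hTT, Matrix.mul_one]
  have hN : N.charpoly = (A * Aᴴ).charpoly.comp (Polynomial.X ^ 2) := by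
    let Q : Matrix (Fin n ⊕ Fin n) (Fin n ⊕ Fin n) (Polynomial ℂ) :=
      fromBlocks (scalar (Fin n) Polynomial.X) 0 (Aᴴ.map Polynomial.C) 1
    have hQ : charmatrix N * Q = fromBlocks
        (scalar (Fin n) (Polynomial.X ^ 2) - (A * Aᴴ).map Polynomial.C) (-A.map Polynomial.C)
        0 (scalar (Fin n) Polynomial.X) := by
      have : charmatrix N = fromBlocks (scalar (Fin n) Polynomial.X) (-A.map Polynomial.C)
          (-Aᴴ.map Polynomial.C) (scalar (Fin n) Polynomial.X) := by
        simp only [N, charmatrix_fromBlocks]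
        congr 1 <;> simp [charmatrix]
      rw [this]
      simp only [Q, fromBlocks_multiply]
      congr 1
      · rw [Matrix.map_mul, ← map_mul, ← sq]
        simp [sub_eq_add_neg]
      · simp
      · simp [scalar_comm, Commute.all, -scalar_apply]
      · simp
    have hd := congrArg det hQ
    rw [det_mul, det_fromBlocks_zero₁₂, det_fromBlocks_zero₂₁, det_one, mul_one] at hd
    have hX : (scalar (Fin n) (Polynomial.X : Polynomial ℂ)).det ≠ 0 := by
      simp
    have hd' := mul_right_cancel₀ hX hd
    rw [charpoly, hd', charpoly, ← Polynomial.coe_compRingHom_apply, RingHom.map_det]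
    generalize A * Aᴴ = B
    congr 1
    ext1 i j
    by_cases hij : i = j <;> simp [charmatrix, hij]
  rw [hc, hN, h, Polynomial.prod_comp, Polynomial.map_prod]
  refine Finset.prod_congr rfl fun i _ => ?_
  simp
  ring

theorem orderedEigenvalue_realForm_of_charpoly {A : Matrix (Fin n) (Fin n) ℂ} (hA : Aᵀ = A) {a : Fin n → ℝ}
    (ha : Antitone a) (ha0 : ∀ i, 0 ≤ a i)
    (h : (A * Aᴴ).charpoly = ∏ i, (Polynomial.X - Polynomial.C ((a i : ℂ) ^ 2))) (i : Fin n) :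
    orderedEigenvalue (realForm A) i = a i ∧
      orderedEigenvalue (realForm A) (n + i) = -a (Fin.rev i) := by
  have hanti : Antitone (Fin.append a fun i => -a (Fin.rev i)) := by
    intro i j hij
    induction i using Fin.addCases with
    | left i =>
      induction j using Fin.addCases with
      | left j =>
        rw [Fin.append_left, Fin.append_left]
        exact ha (show (i : ℕ) ≤ j from hij)
      | right j =>
        rw [Fin.append_left, Fin.append_right]
        linarith [ha0 i, ha0 (Fin.rev j)]
    | right i =>
      induction j using Fin.addCases with
      | left j =>
        exfalso
        rw [Fin.le_def] at hij
        simp at hij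
        omega
      | right j =>
        rw [Fin.append_right, Fin.append_right]
        exact neg_le_neg (ha (Fin.rev_le_rev.2 (by simpa using hij)))
  have hc : (realForm A).charpoly =
      ∏ i, (Polynomial.X - Polynomial.C (Fin.append a (fun i => -a (Fin.rev i)) i)) := by
    rw [charpoly_realForm hA h, Fin.prod_univ_add, Finset.prod_mul_distrib]
    simp only [Fin.append_left, Fin.append_right]
    congr 1
    exact (Fintype.prod_equiv Fin.revPerm _ _ fun i => by simp).symm
  constructor
  · have := orderedEigenvalue_eq_of_charpoly hanti hc (Fin.castAdd n i)
    rwa [Fin.append_left] at this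
  · have := orderedEigenvalue_eq_of_charpoly hanti hc (Fin.natAdd n i)
    rwa [Fin.append_right] at this

theorem charpoly_mul_conjTranspose (A : Matrix (Fin n) (Fin n) ℂ) :
    (A * Aᴴ).charpoly =
      ∏ i : Fin n, (Polynomial.X - Polynomial.C ((singularValue A i : ℂ) ^ 2)) := by
  have hT : LinearMap.adjoint (toEuclideanLin A) ∘ₗ toEuclideanLin A
      = toEuclideanLin (Aᴴ * A) := by
    rw [← toEuclideanLin_conjTranspose_eq_adjoint, toLpLin_mul_same]
  have hc : (toEuclideanLin (Aᴴ * A)).charpoly = (Aᴴ * A).charpoly := by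
    change (toLpLin 2 2 (Aᴴ * A)).charpoly = _
    rw [toLpLin_eq_toLin, charpoly_toLin]
  rw [charpoly_mul_comm, ← hc, ← hT,
    (toEuclideanLin A).isSymmetric_adjoint_comp_self.charpoly_eq (n := n) (by simp)]
  refine Finset.prod_congr rfl fun i _ => ?_
  rw [singularValue, ← LinearMap.sq_singularValues_fin]
  simp

theorem antitone_singularValue (A : Matrix (Fin n) (Fin n) ℂ) :
    Antitone fun i : Fin n => singularValue A i := by
  intro i j hij
  exact (toEuclideanLin A).singularValues_antitone hij

theorem singularValue_nonneg (A : Matrix (Fin n) (Fin n) ℂ) (i : ℕ) : 0 ≤ singularValue A i :=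
  LinearMap.singularValues_nonneg _ i

theorem orderedEigenvalue_realForm {A : Matrix (Fin n) (Fin n) ℂ} (hA : Aᵀ = A) {i : ℕ}
    (hi : i < n) : orderedEigenvalue (realForm A) i = singularValue A i :=
  (orderedEigenvalue_realForm_of_charpoly hA (antitone_singularValue A)
    (fun i => singularValue_nonneg A i) (charpoly_mul_conjTranspose A) ⟨i, hi⟩).1

theorem orderedEigenvalue_realForm_add {A : Matrix (Fin n) (Fin n) ℂ} (hA : Aᵀ = A) {i : ℕ}
    (hi : i < n) : orderedEigenvalue (realForm A) (n + i) = -singularValue A (n - 1 - i) := by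
  rw [(orderedEigenvalue_realForm_of_charpoly hA (antitone_singularValue A)
    (fun i => singularValue_nonneg A i) (charpoly_mul_conjTranspose A) ⟨i, hi⟩).2, Fin.val_rev]
  congr 2
  simp only
  omega

/-- The diagonal of a Takagi factorization consists of the singular values. -/
theorem IsTakagi.eq_singularValue {A U : Matrix (Fin n) (Fin n) ℂ} {S : Fin n → ℝ}
    (h : IsTakagi A U S) (hA : Aᵀ = A) (i : Fin n) : S i = singularValue A i := by
  have hc : (A * Aᴴ).charpoly = ∏ i, (Polynomial.X - Polynomial.C ((S i : ℂ) ^ 2)) := by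
    have hU : Uᴴ * U = 1 := mem_unitaryGroup_iff'.1 h.unitary
    have hU2 : Uᵀ * (Uᵀ)ᴴ = 1 := by
      have := congrArg transpose hU
      rwa [transpose_mul, transpose_one] at this
    set D := diagonal fun i => (S i : ℂ) with hD
    have hDD : Dᴴ = D := by
      rw [hD, diagonal_conjTranspose]
      congr 1
      ext i
      simp
    have : A * Aᴴ = U * (D * D * Uᴴ) := by
      rw [h.factor, conjTranspose_mul, conjTranspose_mul, hDD]
      calc U * D * Uᵀ * ((Uᵀ)ᴴ * (D * Uᴴ)) = U * D * (Uᵀ * (Uᵀ)ᴴ) * D * Uᴴ := by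
            simp only [Matrix.mul_assoc]
        _ = _ := by rw [hU2]; simp only [Matrix.mul_assoc, Matrix.one_mul]
    rw [this, charpoly_mul_comm, Matrix.mul_assoc, hU, Matrix.mul_one, hD, diagonal_mul_diagonal,
      charpoly_diagonal]
    simp only [sq]
  rw [← orderedEigenvalue_realForm hA i.2,
    (orderedEigenvalue_realForm_of_charpoly hA h.antitone h.nonneg hc i).1]

end SingularValues

/-! ### Regularity of simple eigenvectors -/

section Regularity

variable {m : Type*} [Fintype m]

/-- The map whose fibre over `(0, 1)` consists of the matrices with a unit eigenvector and the
corresponding eigenvalue. -/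
def eigenEquation (u : (m → m → ℝ) × ((m → ℝ) × ℝ)) : (m → ℝ) × ℝ :=
  (fun a => ∑ b, u.1 a b * u.2.1 b - u.2.2 * u.2.1 a, ∑ a, u.2.1 a * u.2.1 a)

theorem contDiff_eigenEquation : ContDiff ℝ ∞ (eigenEquation (m := m)) := by
  unfold eigenEquation
  fun_prop

variable [DecidableEq m]

theorem isInvertible_fderiv_eigenEquation {M : Matrix m m ℝ} (hM : M.IsSymm) {i : ℕ}
    (hi : i < Fintype.card m) (hs : IsSimple M i) {v : m → ℝ}
    (hv : M *ᵥ v = orderedEigenvalue M i • v) (hv1 : v ⬝ᵥ v = 1) :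
    (fderiv ℝ eigenEquation ((M, (v, orderedEigenvalue M i)) : (m → m → ℝ) × ((m → ℝ) × ℝ)) ∘L
      .inr ℝ (m → m → ℝ) ((m → ℝ) × ℝ)).IsInvertible := by
  set l := orderedEigenvalue M i with hl
  set u : (m → m → ℝ) × ((m → ℝ) × ℝ) := (M, (v, l)) with hu
  set D := fderiv ℝ eigenEquation u ∘L .inr ℝ (m → m → ℝ) ((m → ℝ) × ℝ) with hD
  have hDval : ∀ h : (m → ℝ) × ℝ, D h =
      (M *ᵥ h.1 - l • h.1 - h.2 • v, 2 * (v ⬝ᵥ h.1)) := by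
    intro h
    have h1 : HasDerivAt (fun s : ℝ => eigenEquation (u + s • ((0, h) : (m → m → ℝ) × ((m → ℝ) × ℝ))))
        (fderiv ℝ eigenEquation u (0, h)) 0 :=
      ((contDiff_eigenEquation.differentiable (by simp)) u).hasFDerivAt.hasLineDerivAt _
    have h2 : HasDerivAt (fun s : ℝ => eigenEquation (u + s • ((0, h) : (m → m → ℝ) × ((m → ℝ) × ℝ))))
        (M *ᵥ h.1 - l • h.1 - h.2 • v, 2 * (v ⬝ᵥ h.1)) 0 := by
      have hlin : ∀ a b : ℝ, HasDerivAt (fun s : ℝ => a + s * b) b 0 := fun a b => by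
        simpa using ((hasDerivAt_id (0 : ℝ)).mul_const b).const_add a
      refine HasDerivAt.prodMk ?_ ?_
      · rw [hasDerivAt_pi]
        intro a
        have := (HasDerivAt.fun_sum (u := Finset.univ) fun b _ =>
          (hlin (v b) (h.1 b)).const_mul (M a b)).sub ((hlin l h.2).mul (hlin (v a) (h.1 a)))
        convert! this using 1
        · funext s
          simp [u]
          exact Finset.sum_congr rfl fun x _ => congrArg (· * _) (add_zero (M a x))
        · simp [mulVec, dotProduct]
          ring
      · have := HasDerivAt.fun_sum (u := Finset.univ) fun b _ =>
          (hlin (v b) (h.1 b)).mul (hlin (v b) (h.1 b))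
        convert! this using 1
        simp only [dotProduct, Finset.mul_sum]
        refine Finset.sum_congr rfl fun b _ => ?_
        ring
    exact h1.unique h2
  have hinj : Function.Injective D := by
    rw [injective_iff_map_eq_zero]
    intro h h0
    rw [hDval, Prod.mk_eq_zero] at h0
    obtain ⟨h1, h2⟩ := h0
    have hvh : v ⬝ᵥ h.1 = 0 := by simpa using h2
    have hμ : h.2 = 0 := by
      have := congrArg (fun w => v ⬝ᵥ w) h1
      simp only [dotProduct_sub, dotProduct_smul, hv1, hvh, dotProduct_zero, dotProduct_mulVec] at this
      rw [← mulVec_transpose, hM.eq, hv, smul_dotProduct, hvh] at this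
      simpa using this
    rw [hμ, zero_smul, sub_zero, sub_eq_zero] at h1
    obtain ⟨f, hf⟩ := exists_isOrderedEigenbasis hM
    have e1 := hf.eq_smul hM (i := ⟨i, hi⟩) hs h1
    have e2 := hf.eq_smul hM (i := ⟨i, hi⟩) hs hv
    have : h.1 = 0 := by
      rw [e2, smul_dotProduct] at hvh
      rcases smul_eq_zero.1 hvh with h | h
      · rw [h, zero_smul] at e2
        rw [e2] at hv1
        simp at hv1
      · rw [e1, h, zero_smul]
    exact Prod.ext this hμ
  exact ⟨(LinearEquiv.ofInjectiveEndo D.toLinearMap hinj).toContinuousLinearEquiv, by ext <;> rfl⟩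

/-- A continuous choice of unit eigenvectors for a simple eigenvalue is as smooth as the matrix:
it is locally the implicit function defined by the eigenvalue equation. -/
theorem contDiffOn_eigenvector {k : ℕ∞} {s : Set ℝ} {M : ℝ → Matrix m m ℝ}
    (hMk : ∀ a b, ContDiffOn ℝ k (fun t => M t a b) s) (hM : ∀ t ∈ s, (M t).IsSymm) {i : ℕ}
    (hi : i < Fintype.card m) (hs : ∀ t ∈ s, IsSimple (M t) i) {v : ℝ → m → ℝ}
    (hvc : ContinuousOn v s)
    (hv : ∀ t ∈ s, M t *ᵥ v t = orderedEigenvalue (M t) i • v t) (hv1 : ∀ t ∈ s, v t ⬝ᵥ v t = 1) :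
    ContDiffOn ℝ k v s := by
  intro t ht
  let M' : ℝ → m → m → ℝ := M
  have hM' : ContDiffOn ℝ k M' s :=
    contDiffOn_pi.2 fun a => contDiffOn_pi.2 fun b => hMk a b
  have hlam : ∀ r ∈ s, orderedEigenvalue (M r) i = v r ⬝ᵥ M r *ᵥ v r := by
    intro r hr
    rw [hv r hr, dotProduct_smul, hv1 r hr, smul_eq_mul, mul_one]
  let u : ℝ → (m → m → ℝ) × ((m → ℝ) × ℝ) := fun r => (M' r, (v r, orderedEigenvalue (M r) i))
  have hMc : ContinuousOn M s := hM'.continuousOn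
  have hu : ContinuousWithinAt u s t := by
    have h1 : ContinuousOn (fun r => v r ⬝ᵥ M r *ᵥ v r) s := by
      have hc : Continuous fun p : Matrix m m ℝ × (m → ℝ) => p.2 ⬝ᵥ p.1 *ᵥ p.2 := by fun_prop
      exact hc.comp_continuousOn (hMc.prodMk hvc)
    exact (hM'.continuousOn.prodMk (hvc.prodMk (h1.congr hlam))) t ht
  have heq : ∀ r ∈ s, eigenEquation (u r) = (0, 1) := by
    intro r hr
    refine Prod.ext ?_ (hv1 r hr)
    ext a
    have := congrFun (hv r hr) a
    simp only [mulVec, dotProduct, Pi.smul_apply, smul_eq_mul] at this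
    simp [eigenEquation, u, M', this]
  have hf : ContDiffAt ℝ ∞ eigenEquation (u t) := contDiff_eigenEquation.contDiffAt
  have hinv := isInvertible_fderiv_eigenEquation (hM t ht) hi (hs t ht) (hv t ht) (hv1 t ht)
  have hψ := hf.contDiffAt_implicitFunction (by simp) hinv
  have hev : ∀ᶠ r in 𝓝[s] t, hf.implicitFunction (by simp) hinv (M' r) = (u r).2 := by
    filter_upwards [hu.eventually (hf.eventually_apply_eq_iff_implicitFunction (by simp) hinv),
      self_mem_nhdsWithin] with r hr hrs
    exact hr.1 (by rw [heq r hrs, heq t ht])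
  have hcomp : ContDiffWithinAt ℝ k (fun r => (hf.implicitFunction (by simp) hinv (M' r)).1) s t :=
    ((hψ.of_le (m := k) (mod_cast le_top)).comp_contDiffWithinAt t (hM' t ht)).fst
  refine hcomp.congr_of_eventuallyEq ?_ ?_
  · filter_upwards [hev] with r hr
    rw [hr]
  · rw [hev.self_of_nhdsWithin ht]

end Regularity

/-! ### Takagi factorizations and real eigenvectors -/

section Continuation

variable {n : ℕ}

/-- The real coordinates of a complex vector. In these, `realForm A` is the antilinear map
`u ↦ A ū`. -/
def realVec (u : Fin n → ℂ) : Fin n ⊕ Fin n → ℝ :=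
  Sum.elim (fun r => (u r).re) (fun r => (u r).im)

theorem realVec_injective : Function.Injective (realVec (n := n)) := by
  intro u w h
  ext r
  exact Complex.ext (congrFun h (Sum.inl r)) (congrFun h (Sum.inr r))

theorem realVec_neg (u : Fin n → ℂ) : realVec (-u) = -realVec u := by
  ext (r | r) <;> simp [realVec]

theorem realForm_mulVec (A : Matrix (Fin n) (Fin n) ℂ) (u : Fin n → ℂ) :
    realForm A *ᵥ realVec u = realVec (A *ᵥ star u) := by
  ext (r | r)
  · simp [realForm, realVec, mulVec, dotProduct, Finset.sum_add_distrib]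
  · simp [realForm, realVec, mulVec, dotProduct, Finset.sum_add_distrib, Finset.sum_neg_distrib]
    ring

theorem realVec_smul (s : ℝ) (u : Fin n → ℂ) : realVec ((s : ℂ) • u) = s • realVec u := by
  ext (r | r) <;> simp [realVec]

theorem realVec_dotProduct_self (u : Fin n → ℂ) :
    ((realVec u ⬝ᵥ realVec u : ℝ) : ℂ) = star u ⬝ᵥ u := by
  simp only [realVec, dotProduct, Fintype.sum_sum_type, Sum.elim_inl, Sum.elim_inr,
    ← Finset.sum_add_distrib]
  push_cast
  refine Finset.sum_congr rfl fun r _ => ?_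
  apply Complex.ext <;> simp
  ring

/-- The real coordinates of the columns of a Takagi factor are unit eigenvectors. -/
theorem IsTakagi.realForm_mulVec_col {A U : Matrix (Fin n) (Fin n) ℂ} {S : Fin n → ℝ}
    (h : IsTakagi A U S) (c : Fin n) :
    realForm A *ᵥ realVec (U.col c) = S c • realVec (U.col c) ∧
      realVec (U.col c) ⬝ᵥ realVec (U.col c) = 1 := by
  have hU : Uᴴ * U = 1 := mem_unitaryGroup_iff'.1 h.unitary
  have hU2 : Uᵀ * (Uᵀ)ᴴ = 1 := by
    have := congrArg transpose hU
    rwa [transpose_mul, transpose_one] at this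
  constructor
  · rw [realForm_mulVec, ← realVec_smul]
    congr 1
    have hAU : A * (Uᵀ)ᴴ = U * diagonal fun i => (S i : ℂ) := by
      rw [h.factor, Matrix.mul_assoc, hU2, Matrix.mul_one]
    ext r
    have := congrFun (congrFun hAU r) c
    rw [mul_diagonal] at this
    rw [Pi.smul_apply, smul_eq_mul, mul_comm, col_apply, ← this]
    rfl
  · have := congrFun (congrFun hU c) c
    rw [one_apply_eq] at this
    have h2 := realVec_dotProduct_self (U.col c)
    rw [show star (U.col c) ⬝ᵥ U.col c = 1 from this] at h2
    exact_mod_cast h2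

/-- Unit eigenvectors of `realForm A` for distinct eigenvalues, read as complex vectors, are
orthogonal over `ℂ`, and thus constitute a Takagi factor. -/
theorem isTakagi_of_eigenvectors {A U : Matrix (Fin n) (Fin n) ℂ} {S : Fin n → ℝ} (hA : Aᵀ = A)
    (hS : Antitone S) (hS0 : ∀ i, 0 ≤ S i) (hinj : Function.Injective S)
    (h : ∀ c, realForm A *ᵥ realVec (U.col c) = S c • realVec (U.col c))
    (h1 : ∀ c, realVec (U.col c) ⬝ᵥ realVec (U.col c) = 1) : IsTakagi A U S := by
  have hcol : ∀ c, A *ᵥ star (U.col c) = (S c : ℂ) • U.col c := fun c =>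
    realVec_injective (by rw [← realForm_mulVec, h, realVec_smul])
  have hAU : A * (Uᵀ)ᴴ = U * diagonal fun i => (S i : ℂ) := by
    ext r c
    have := congrFun (hcol c) r
    rw [Pi.smul_apply, smul_eq_mul, mul_comm, col_apply] at this
    rw [mul_diagonal, ← this]
    rfl
  have hU : Uᴴ * U = 1 := by
    -- `Uᴴ A Ū = Uᴴ U S` is symmetric, as `A` is.
    have hsym : (Uᴴ * (A * (Uᵀ)ᴴ))ᵀ = Uᴴ * (A * (Uᵀ)ᴴ) := by
      rw [transpose_mul, transpose_mul, hA, Matrix.mul_assoc]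
      rfl
    rw [hAU, ← Matrix.mul_assoc] at hsym
    ext c d
    by_cases hcd : c = d
    · subst hcd
      have := realVec_dotProduct_self (U.col c)
      rw [h1] at this
      rw [one_apply_eq]
      exact_mod_cast this.symm
    · rw [one_apply_ne hcd]
      have e := congrFun (congrFun hsym c) d
      rw [transpose_apply, mul_diagonal, mul_diagonal] at e
      have hstar : (Uᴴ * U) d c = star ((Uᴴ * U) c d) := by
        rw [← conjTranspose_apply, conjTranspose_mul, conjTranspose_conjTranspose]
      rw [hstar] at e
      have hne : S c ≠ S d := fun h => hcd (hinj h)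
      have e1 := congrArg Complex.re e
      have e2 := congrArg Complex.im e
      simp only [RCLike.star_def, Complex.mul_re, Complex.mul_im, Complex.conj_re, Complex.conj_im,
        Complex.ofReal_re, Complex.ofReal_im] at e1 e2
      apply Complex.ext
      · have : ((Uᴴ * U) c d).re * (S c - S d) = 0 := by linarith
        simpa [sub_ne_zero.2 hne] using this
      · have : ((Uᴴ * U) c d).im * (S c + S d) = 0 := by linarith
        have h0 : S c + S d ≠ 0 := fun h0 => hne (by linarith [hS0 c, hS0 d])
        simpa [h0] using this
  have hU2 : (Uᵀ)ᴴ * Uᵀ = 1 := by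
    have h2 : U * Uᴴ = 1 := mul_eq_one_comm.1 hU
    have := congrArg transpose h2
    rwa [transpose_mul, transpose_one] at this
  refine ⟨mem_unitaryGroup_iff'.2 hU, hS, hS0, ?_⟩
  rw [← hAU, Matrix.mul_assoc, hU2, Matrix.mul_one]

/-- Along with the values `σ_i`, the eigenvalues of `realForm A` are the `-σ_i`. -/
theorem isSimple_realForm {A : Matrix (Fin n) (Fin n) ℂ} (hA : Aᵀ = A) {i : ℕ} (hi : i < n)
    (h : ∀ j < n, j ≠ i → singularValue A j ≠ singularValue A i) (h0 : singularValue A i ≠ 0) :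
    IsSimple (realForm A) i := by
  intro j hj hji
  rw [orderedEigenvalue_realForm hA hi]
  rcases lt_or_ge j n with hjn | hjn
  · rw [orderedEigenvalue_realForm hA hjn]
    exact h j hjn hji
  · obtain ⟨j, rfl⟩ := Nat.exists_eq_add_of_le hjn
    simp only [Fintype.card_sum, Fintype.card_fin] at hj
    rw [orderedEigenvalue_realForm_add hA (by omega)]
    have h1 := singularValue_nonneg A (n - 1 - j)
    have h2 := (singularValue_nonneg A i).lt_of_ne' h0
    linarith

theorem lt_card_sum {i : ℕ} (hi : i < n) : i < Fintype.card (Fin n ⊕ Fin n) := by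
  simp
  omega

theorem continuous_realVec : Continuous (realVec (n := n)) := by
  refine continuous_pi fun a => ?_
  rcases a with r | r
  · exact Complex.continuous_re.comp (continuous_apply r)
  · exact Complex.continuous_im.comp (continuous_apply r)

theorem continuousOn_realForm {Y : Type*} [TopologicalSpace Y] {A : Y → Matrix (Fin n) (Fin n) ℂ}
    {s : Set Y} (hA : ∀ r c, ContinuousOn (fun y => A y r c) s) :
    ContinuousOn (fun y => realForm (A y)) s := by
  refine continuousOn_pi.2 fun a => continuousOn_pi.2 fun b => ?_
  have hre := fun r c => Complex.continuous_re.comp_continuousOn (hA r c)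
  have him := fun r c => Complex.continuous_im.comp_continuousOn (hA r c)
  rcases a with a | a <;> rcases b with b | b
  · exact hre a b
  · exact him a b
  · exact him a b
  · exact (hre a b).neg

theorem contDiffOn_realForm {k : ℕ∞} {A : ℝ → Matrix (Fin n) (Fin n) ℂ} {s : Set ℝ}
    (hA : ∀ r c, ContDiffOn ℝ k (fun y => A y r c) s) (a b : Fin n ⊕ Fin n) :
    ContDiffOn ℝ k (fun y => realForm (A y) a b) s := by
  have hre := fun r c => Complex.reCLM.contDiff.comp_contDiffOn (hA r c)
  have him := fun r c => Complex.imCLM.contDiff.comp_contDiffOn (hA r c)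
  rcases a with a | a <;> rcases b with b | b
  · exact hre a b
  · exact him a b
  · exact him a b
  · exact (hre a b).neg

/-- The column of a Takagi factor spans the eigenline of a simple eigenvalue. -/
theorem IsTakagi.eigenline_eq {A U : Matrix (Fin n) (Fin n) ℂ} {S : Fin n → ℝ}
    (h : IsTakagi A U S) (hA : Aᵀ = A) {c : Fin n} (hs : IsSimple (realForm A) c) :
    eigenline (realForm A) c = vecMulVec (realVec (U.col c)) (realVec (U.col c)) := by
  obtain ⟨h1, h2⟩ := h.realForm_mulVec_col c
  refine Takagi.eigenline_eq (isSymm_realForm hA) (lt_card_sum c.2) hs ?_ h2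
  rw [orderedEigenvalue_realForm hA c.2, ← h.eq_singularValue hA c, h1]

variable {k : ℕ∞} {A : ℝ → Matrix (Fin n) (Fin n) ℂ}

theorem IsSmoothTakagi.continuousOn_realVec {U : ℝ → Matrix (Fin n) (Fin n) ℂ} {S : ℝ → Fin n → ℝ}
    (h : IsSmoothTakagi k A U S) (c : Fin n) :
    ContinuousOn (fun t => realVec ((U t).col c)) (Icc 0 1) :=
  continuous_realVec.comp_continuousOn
    (continuousOn_pi.2 fun r => (h.contDiffOn_unitary r c).continuousOn)

/-- Two smooth Takagi factorizations with the same initial value coincide: corresponding columns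
agree up to a sign, which is constant. -/
theorem IsSmoothTakagi.eqOn {U U' : ℝ → Matrix (Fin n) (Fin n) ℂ} {S S' : ℝ → Fin n → ℝ}
    (h : IsSmoothTakagi k A U S) (h' : IsSmoothTakagi k A U' S')
    (hA : ∀ t ∈ Icc (0 : ℝ) 1, (A t)ᵀ = A t)
    (hs : ∀ t ∈ Icc (0 : ℝ) 1, ∀ i < n, IsSimple (realForm (A t)) i) (h0 : U' 0 = U 0) :
    EqOn U' U (Icc 0 1) ∧ EqOn S' S (Icc 0 1) := by
  constructor
  · intro t ht
    suffices H : ∀ c, realVec ((U' t).col c) = realVec ((U t).col c) by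
      ext r c
      exact congrFun (realVec_injective (H c)) r
    intro c
    let g : ℝ → ℝ := fun t => realVec ((U' t).col c) ⬝ᵥ realVec ((U t).col c)
    have hg : ContinuousOn g (Icc 0 1) := by
      have hc : Continuous fun p : (Fin n ⊕ Fin n → ℝ) × (Fin n ⊕ Fin n → ℝ) => p.1 ⬝ᵥ p.2 := by
        fun_prop
      exact hc.comp_continuousOn ((h'.continuousOn_realVec c).prodMk (h.continuousOn_realVec c))
    have hsign : ∀ r ∈ Icc (0 : ℝ) 1, realVec ((U' r).col c) = realVec ((U r).col c) ∨
        realVec ((U' r).col c) = -realVec ((U r).col c) := fun r hr =>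
      eq_or_eq_neg_of_vecMulVec_eq
        (((h'.takagi r hr).eigenline_eq (hA r hr) (hs r hr c c.2)).symm.trans
          ((h.takagi r hr).eigenline_eq (hA r hr) (hs r hr c c.2)))
    have hg0 : g 0 = 1 := by
      simp only [g, h0]
      exact ((h.takagi 0 (by simp)).realForm_mulVec_col c).2
    rcases hsign t ht with e | e
    · exact e
    · exfalso
      have hgt : g t = -1 := by
        simp only [g, e, neg_dotProduct, ((h.takagi t ht).realForm_mulVec_col c).2]
      have hsub : Icc 0 t ⊆ Icc (0 : ℝ) 1 := Icc_subset_Icc_right ht.2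
      obtain ⟨r, hr, hr0⟩ := intermediate_value_Icc' ht.1 (hg.mono hsub)
        (show (0 : ℝ) ∈ Icc (g t) (g 0) by rw [hg0, hgt]; norm_num)
      have h1 := ((h.takagi r (hsub hr)).realForm_mulVec_col c).2
      rcases hsign r (hsub hr) with e | e <;> simp [g, e, h1] at hr0
  · intro t ht
    ext c
    rw [(h.takagi t ht).eq_singularValue (hA t ht), (h'.takagi t ht).eq_singularValue (hA t ht)]

/-- A Takagi factorization can be continued smoothly along a path on which the singular values are
distinct and nonzero. -/
theorem exists_isSmoothTakagi (hAk : ∀ r c, ContDiffOn ℝ k (fun t => A t r c) (Icc 0 1))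
    (hA : ∀ t ∈ Icc (0 : ℝ) 1, (A t)ᵀ = A t)
    (hdist : ∀ t ∈ Icc (0 : ℝ) 1, InjOn (singularValue (A t)) (Iio n))
    (hs : ∀ t ∈ Icc (0 : ℝ) 1, ∀ i < n, IsSimple (realForm (A t)) i)
    {U₀ : Matrix (Fin n) (Fin n) ℂ} {S₀ : Fin n → ℝ} (h₀ : IsTakagi (A 0) U₀ S₀) :
    ∃ U S, IsSmoothTakagi k A U S ∧ U 0 = U₀ ∧ S 0 = S₀ := by
  have h0 : (0 : ℝ) ∈ Icc (0 : ℝ) 1 := by simp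
  have hMc := continuousOn_realForm fun r c => (hAk r c).continuousOn
  have hv : ∀ c : Fin n, ∃ v : ℝ → Fin n ⊕ Fin n → ℝ, Continuous v ∧ v 0 = realVec (U₀.col c) ∧
      ∀ t ∈ Icc (0 : ℝ) 1, eigenline (realForm (A t)) c = vecMulVec (v t) (v t) := by
    intro c
    have hcont : Continuous fun t : Icc (0 : ℝ) 1 => eigenline (realForm (A t)) c := by
      exact continuousOn_iff_continuous_domRestrict.1 (continuousOn_eigenline hMc
        (fun t ht => isSymm_realForm (hA t ht)) (lt_card_sum c.2) fun t ht => hs t ht c c.2)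
    obtain ⟨v, hv, hPv⟩ := hasLift_Icc hcont
      fun t => isLine_eigenline (isSymm_realForm (hA t t.2)) (lt_card_sum c.2)
    have hext : ∀ t (ht : t ∈ Icc (0 : ℝ) 1), IccExtend zero_le_one v t = v ⟨t, ht⟩ :=
      fun t ht => IccExtend_of_mem _ _ ht
    have hvc : Continuous (IccExtend (zero_le_one (α := ℝ)) v) := hv.Icc_extend'
    rcases eq_or_eq_neg_of_vecMulVec_eq
      ((h₀.eigenline_eq (hA 0 h0) (hs 0 h0 c c.2)).symm.trans (hPv ⟨0, h0⟩)) with e | e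
    · refine ⟨_, hvc, by rw [hext 0 h0, e], fun t ht => ?_⟩
      rw [hext t ht]
      exact hPv ⟨t, ht⟩
    · refine ⟨fun t => -IccExtend (zero_le_one (α := ℝ)) v t, hvc.neg, by simp only [hext 0 h0, e],
        fun t ht => ?_⟩
      simp only [hext t ht]
      rw [vecMulVec_neg, neg_vecMulVec, neg_neg]
      exact hPv ⟨t, ht⟩
  choose v hvc hv0 hPv using hv
  have hve : ∀ c : Fin n, ∀ t ∈ Icc (0 : ℝ) 1,
      realForm (A t) *ᵥ v c t = orderedEigenvalue (realForm (A t)) c • v c t ∧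
        v c t ⬝ᵥ v c t = 1 := fun c t ht =>
    eigenvector_of_eigenline_eq (isSymm_realForm (hA t ht)) (lt_card_sum c.2) (hPv c t ht)
  have hvk : ∀ c, ContDiffOn ℝ k (v c) (Icc 0 1) := fun c =>
    contDiffOn_eigenvector (contDiffOn_realForm hAk) (fun t ht => isSymm_realForm (hA t ht))
      (lt_card_sum c.2) (fun t ht => hs t ht c c.2) (hvc c).continuousOn
      (fun t ht => (hve c t ht).1) (fun t ht => (hve c t ht).2)
  let U : ℝ → Matrix (Fin n) (Fin n) ℂ := fun t =>
    of fun r c => (v c t (Sum.inl r) : ℂ) + v c t (Sum.inr r) * Complex.I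
  have hU : ∀ t c, realVec ((U t).col c) = v c t := by
    intro t c
    ext (r | r) <;> simp [realVec, U]
  refine ⟨U, fun t c => singularValue (A t) c, ⟨fun t ht => ?_, fun r c => ?_, fun c => ?_⟩, ?_, ?_⟩
  · refine isTakagi_of_eigenvectors (hA t ht) (antitone_singularValue _)
      (fun c => singularValue_nonneg _ _)
      (fun c d h => Fin.ext (hdist t ht c.2 d.2 h)) (fun c => ?_) fun c => ?_
    · rw [hU, (hve c t ht).1, orderedEigenvalue_realForm (hA t ht) c.2]
    · rw [hU, (hve c t ht).2]
  · have hcoord := fun a => contDiffOn_pi.1 (hvk c) a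
    exact (Complex.ofRealCLM.contDiff.comp_contDiffOn (hcoord (Sum.inl r))).add
      ((Complex.ofRealCLM.contDiff.comp_contDiffOn (hcoord (Sum.inr r))).mul contDiffOn_const)
  · have hsv : ∀ t ∈ Icc (0 : ℝ) 1, singularValue (A t) c =
        ∑ a, v c t a * ∑ b, realForm (A t) a b * v c t b := by
      intro t ht
      have h1 := congrArg (fun w => v c t ⬝ᵥ w) (hve c t ht).1
      simp only [dotProduct_smul, (hve c t ht).2, orderedEigenvalue_realForm (hA t ht) c.2,
        smul_eq_mul, mul_one] at h1
      exact h1.symm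
    refine ContDiffOn.congr ?_ hsv
    have hcoord := fun a => contDiffOn_pi.1 (hvk c) a
    exact ContDiffOn.sum fun a _ => (hcoord a).mul
      (ContDiffOn.sum fun b _ => (contDiffOn_realForm hAk a b).mul (hcoord b))
  · ext r c
    exact congrFun (realVec_injective ((hU 0 c).trans (hv0 c))) r
  · ext c
    exact (h₀.eq_singularValue (hA 0 h0) c).symm

end Continuation

/-! ### Eigenvectors near a generic coalescing point -/

section Coalescing

variable {Y E : Type*} [NormedAddCommGroup E] [NormedSpace ℝ E]

theorem tendsto_inv_norm_smul_of_isLittleO {G : Filter Y} {η : Y → Plane}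
    (hη : Tendsto η G (𝓝[≠] 0)) {x : Plane} {g : Plane → E}
    (hg : g =o[𝓝 x] fun y => y - x) : Tendsto (fun y => ‖η y‖⁻¹ • g (x + η y)) G (𝓝 0) := by
  have h0 : Tendsto (fun y => x + η y) G (𝓝 x) := by
    simpa using (hη.mono_right nhdsWithin_le_nhds).const_add x
  have h1 := hg.comp_tendsto h0
  simp only [Function.comp_def, add_sub_cancel_left] at h1
  exact h1.norm_right.tendsto_inv_smul_nhds_zero

variable {m : Type*} [Fintype m]

/-- First-order perturbation theory for an eigenvalue with a conical expansion: limits of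
eigenvectors, as `x` is approached in the direction `e`, are eigenvectors of the derivative in the
direction `e`, compressed to the eigenspace at `x`; the eigenvalue is read off the expansion. -/
theorem limit_eigenvector {M : Plane → Matrix m m ℝ} {x : Plane} (hx : (M x).IsSymm)
    {D : Plane →L[ℝ] (m → m → ℝ)} (hD : HasFDerivAt (fun y r c => M y r c) D x)
    {lam : Plane → ℝ} {l : Plane →L[ℝ] ℝ} {L : Plane →L[ℝ] Plane} {s : ℝ}
    (hlam : (fun y => lam y - (lam x + l (y - x) + s * ‖L (y - x)‖)) =o[𝓝 x] fun y => y - x)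
    (G : Ultrafilter Y) {η : Y → Plane} (hη : Tendsto η G (𝓝[≠] 0)) {e : Plane}
    (he : Tendsto (fun y => ‖η y‖⁻¹ • η y) G (𝓝 e)) {v : Y → m → ℝ} {a : m → ℝ}
    (hva : Tendsto v G (𝓝 a))
    (hv : ∀ᶠ y in (G : Filter Y), M (x + η y) *ᵥ v y = lam (x + η y) • v y) :
    M x *ᵥ a = lam x • a ∧ ∀ z : m → ℝ, M x *ᵥ z = lam x • z →
      z ⬝ᵥ (of (D e) *ᵥ a) = (l e + s * ‖L e‖) * (z ⬝ᵥ a) := by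
  have hη0 : Tendsto η G (𝓝 0) := hη.mono_right nhdsWithin_le_nhds
  have hne : ∀ᶠ y in (G : Filter Y), η y ≠ 0 := hη self_mem_nhdsWithin
  have hδ : Tendsto (fun y => ‖η y‖⁻¹ * (lam (x + η y) - lam x)) G (𝓝 (l e + s * ‖L e‖)) := by
    have h1 := tendsto_inv_norm_smul_of_isLittleO hη hlam
    have h2 : Tendsto (fun y => l (‖η y‖⁻¹ • η y) + s * ‖L (‖η y‖⁻¹ • η y)‖) G
        (𝓝 (l e + s * ‖L e‖)) :=
      ((l.continuous.add (continuous_const.mul L.continuous.norm)).tendsto e).comp he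
    have h3 := h1.add h2
    rw [zero_add] at h3
    refine h3.congr fun y => ?_
    simp only [add_sub_cancel_left, smul_eq_mul, map_smul, norm_smul, norm_inv, norm_norm]
    ring
  have hB : Tendsto (fun y => (‖η y‖⁻¹ • (M (x + η y) - M x) : Matrix m m ℝ)) G
      (𝓝 (of (D e))) := by
    let F : Plane → m → m → ℝ := fun y r c => M y r c
    suffices h : Tendsto (fun y => ‖η y‖⁻¹ • (F (x + η y) - F x)) G (𝓝 (D e)) from h
    have h1 := tendsto_inv_norm_smul_of_isLittleO hη (E := m → m → ℝ)
      (g := fun y => F y - F x - D (y - x)) hD.isLittleO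
    have h2 : Tendsto (fun y => D (‖η y‖⁻¹ • η y)) G (𝓝 (D e)) :=
      (D.continuous.tendsto e).comp he
    have h3 := h1.add h2
    rw [zero_add] at h3
    refine h3.congr fun y => ?_
    rw [add_sub_cancel_left, map_smul, ← smul_add, sub_add_cancel]
  have hMt : Tendsto (fun y => M (x + η y)) G (𝓝 (M x)) := by
    have : Tendsto (fun y => x + η y) G (𝓝 x) := by simpa using hη0.const_add x
    exact hD.continuousAt.tendsto.comp this
  have hlt : Tendsto (fun y => lam (x + η y)) G (𝓝 (lam x)) := by
    have h1 := (hη0.norm.mul hδ).add_const (lam x)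
    rw [norm_zero, zero_mul, zero_add] at h1
    refine h1.congr' ?_
    filter_upwards [hne] with y hy
    have : ‖η y‖ ≠ 0 := norm_ne_zero_iff.2 hy
    field_simp
    ring
  have hc : Continuous fun p : Matrix m m ℝ × (m → ℝ) => p.1 *ᵥ p.2 := by fun_prop
  refine ⟨?_, fun z hz => ?_⟩
  · refine tendsto_nhds_unique ((hc.tendsto (M x, a)).comp (hMt.prodMk_nhds hva)) ?_
    refine (hlt.smul hva).congr' ?_
    filter_upwards [hv] with y hy
    exact hy.symm
  · have hcz : Continuous fun p : Matrix m m ℝ × (m → ℝ) => z ⬝ᵥ p.1 *ᵥ p.2 := by fun_prop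
    have hcd : Continuous fun w : m → ℝ => z ⬝ᵥ w := by fun_prop
    refine tendsto_nhds_unique ((hcz.tendsto (of (D e), a)).comp (hB.prodMk_nhds hva)) ?_
    refine (hδ.mul ((hcd.tendsto a).comp hva)).congr' ?_
    filter_upwards [hv] with y hy
    have h1 : z ⬝ᵥ M x *ᵥ v y = lam x * (z ⬝ᵥ v y) := by
      rw [dotProduct_mulVec, ← mulVec_transpose, hx.eq, hz, smul_dotProduct, smul_eq_mul]
    simp only [Function.comp_apply]
    rw [smul_mulVec, sub_mulVec, hy, dotProduct_smul, dotProduct_sub, h1, dotProduct_smul]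
    simp only [smul_eq_mul]
    ring

variable [DecidableEq m]

/-- Near a coalescing point `x` of two eigenvalues, the unit eigenvectors at `x + h` and `x - h` for
the same sheet of the double cone have independent projections to the eigenspace at `x`. Indeed,
by oddness of the derivative, their limits belong to the two different eigenvalues
`ℓ e ± s ‖L e‖` of the compressed derivative. -/
theorem eventually_independent_of_cone {M : Plane → Matrix m m ℝ} {x : Plane}
    (hx : (M x).IsSymm) (hM : ∀ r c, DifferentiableAt ℝ (fun y => M y r c) x)
    {i q : ℕ} (hi : i < Fintype.card m) (hq : q < Fintype.card m) (hiq : i ≠ q)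
    (hsep : ∀ j < Fintype.card m, j ≠ i → j ≠ q →
      orderedEigenvalue (M x) j ≠ orderedEigenvalue (M x) i)
    {l : Plane →L[ℝ] ℝ} {L : Plane →L[ℝ] Plane} (hL : Function.Injective L) {s : ℝ} (hs : s ≠ 0)
    (hlam : (fun y => orderedEigenvalue (M y) i -
      (orderedEigenvalue (M x) i + l (y - x) + s * ‖L (y - x)‖)) =o[𝓝 x] fun y => y - x) :
    ∃ a b : m → ℝ, ∀ᶠ h in 𝓝[≠] (0 : Plane), ∀ v v' : m → ℝ,
      M (x + h) *ᵥ v = orderedEigenvalue (M (x + h)) i • v → v ⬝ᵥ v = 1 →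
      M (x - h) *ᵥ v' = orderedEigenvalue (M (x - h)) i • v' → v' ⬝ᵥ v' = 1 →
      (a ⬝ᵥ v) * (b ⬝ᵥ v') ≠ (b ⬝ᵥ v) * (a ⬝ᵥ v') := by
  obtain ⟨f, hf⟩ := exists_isOrderedEigenbasis hx
  set I : Fin (Fintype.card m) := ⟨i, hi⟩
  set Q : Fin (Fintype.card m) := ⟨q, hq⟩
  have hIQ : I ≠ Q := fun h => hiq (congrArg Fin.val h)
  have hspan : ∀ z : m → ℝ, M x *ᵥ z = orderedEigenvalue (M x) i • z →
      z = (f I ⬝ᵥ z) • f I + (f Q ⬝ᵥ z) • f Q := by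
    intro z hz
    conv_lhs => rw [eq_sum_of_orthonormal hf.orthonormal z]
    refine Fintype.sum_eq_add I Q hIQ fun j hj => ?_
    rw [dotProduct_eigenvectors_eq_zero hx (hf.mulVec j) hz
      (hsep j j.2 (fun h => hj.1 (Fin.ext h)) fun h => hj.2 (Fin.ext h)), zero_smul]
  refine ⟨f I, f Q, ?_⟩
  by_contra hcon
  rw [not_eventually] at hcon
  push Not at hcon
  set bad : Set Plane := {h | ∃ v v' : m → ℝ,
      M (x + h) *ᵥ v = orderedEigenvalue (M (x + h)) i • v ∧ v ⬝ᵥ v = 1 ∧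
      M (x - h) *ᵥ v' = orderedEigenvalue (M (x - h)) i • v' ∧ v' ⬝ᵥ v' = 1 ∧
      (f I ⬝ᵥ v) * (f Q ⬝ᵥ v') = (f Q ⬝ᵥ v) * (f I ⬝ᵥ v')} with hbad
  have hNe : (𝓝[≠] (0 : Plane) ⊓ 𝓟 bad).NeBot := frequently_mem_iff_neBot.1 hcon
  let G := Ultrafilter.of (𝓝[≠] (0 : Plane) ⊓ 𝓟 bad)
  have hG : (G : Filter Plane) ≤ 𝓝[≠] (0 : Plane) ⊓ 𝓟 bad := Ultrafilter.of_le _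
  have hη : Tendsto (fun h : Plane => h) G (𝓝[≠] 0) := hG.trans inf_le_left
  have hGbad : ∀ᶠ h in (G : Filter Plane), h ∈ bad := by
    have := hG.trans inf_le_right
    rwa [le_principal_iff] at this
  have hch : ∀ h, ∃ v v' : m → ℝ, h ∈ bad →
      M (x + h) *ᵥ v = orderedEigenvalue (M (x + h)) i • v ∧ v ⬝ᵥ v = 1 ∧
      M (x - h) *ᵥ v' = orderedEigenvalue (M (x - h)) i • v' ∧ v' ⬝ᵥ v' = 1 ∧
      (f I ⬝ᵥ v) * (f Q ⬝ᵥ v') = (f Q ⬝ᵥ v) * (f I ⬝ᵥ v') := by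
    intro h
    by_cases hh : h ∈ bad
    · obtain ⟨v, v', H⟩ := hh
      exact ⟨v, v', fun _ => H⟩
    · exact ⟨0, 0, fun h' => absurd h' hh⟩
  choose v v' hvv using hch
  obtain ⟨a, ha1, ha⟩ := exists_tendsto_unitVectors G (v := v)
    (hGbad.mono fun h hh => (hvv h hh).2.1)
  obtain ⟨a', ha1', ha'⟩ := exists_tendsto_unitVectors G (v := v')
    (hGbad.mono fun h hh => (hvv h hh).2.2.2.1)
  obtain ⟨e, he1, he⟩ := (isCompact_sphere (0 : Plane) 1).ultrafilter_le_nhds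
    (G.map fun h => ‖h‖⁻¹ • h) (by
      rw [le_principal_iff]
      change ∀ᶠ h in (G : Filter Plane), ‖h‖⁻¹ • h ∈ Metric.sphere (0 : Plane) 1
      filter_upwards [hη self_mem_nhdsWithin] with h hh
      have : ‖h‖ ≠ 0 := norm_ne_zero_iff.2 hh
      simp [norm_smul, this])
  have he : Tendsto (fun h : Plane => ‖h‖⁻¹ • h) G (𝓝 e) := he
  obtain ⟨D, hD⟩ : ∃ D : Plane →L[ℝ] (m → m → ℝ),
      HasFDerivAt (fun y r c => M y r c) D x :=
    ⟨_, (differentiableAt_pi.2 fun r => differentiableAt_pi.2 fun c => hM r c).hasFDerivAt⟩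
  obtain ⟨hMa, hDa⟩ := limit_eigenvector hx hD (lam := fun y => orderedEigenvalue (M y) i) hlam G hη
    he ha (hGbad.mono fun h hh => (hvv h hh).1)
  obtain ⟨hMa', hDa'⟩ := limit_eigenvector hx hD (lam := fun y => orderedEigenvalue (M y) i) hlam G
    (η := fun h => -h) (e := -e)
    (by
      refine tendsto_nhdsWithin_iff.2 ⟨?_, ?_⟩
      · simpa using (hη.mono_right nhdsWithin_le_nhds).neg
      · filter_upwards [hη self_mem_nhdsWithin] with h hh
        simpa using hh)
    (by simpa using he.neg) ha' (hGbad.mono fun h hh => by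
      simpa only [← sub_eq_add_neg] using (hvv h hh).2.2.1)
  have hdet : (f I ⬝ᵥ a) * (f Q ⬝ᵥ a') = (f Q ⬝ᵥ a) * (f I ⬝ᵥ a') := by
    have hc : Continuous fun p : (m → ℝ) × (m → ℝ) =>
      (f I ⬝ᵥ p.1) * (f Q ⬝ᵥ p.2) - (f Q ⬝ᵥ p.1) * (f I ⬝ᵥ p.2) := by fun_prop
    refine sub_eq_zero.1 (tendsto_nhds_unique
      ((hc.tendsto (a, a')).comp (ha.prodMk_nhds ha')) (tendsto_const_nhds.congr' ?_))
    filter_upwards [hGbad] with h hh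
    simp [(hvv h hh).2.2.2.2]
  have hII : f I ⬝ᵥ f I = 1 := by simp [hf.orthonormal]
  have hQQ : f Q ⬝ᵥ f Q = 1 := by simp [hf.orthonormal]
  have hIQ0 : f I ⬝ᵥ f Q = 0 := by simp [hf.orthonormal, hIQ]
  have hQI0 : f Q ⬝ᵥ f I = 0 := by simp [hf.orthonormal, hIQ.symm]
  have hsa := hspan a hMa
  have hsa' := hspan a' hMa'
  set α := f I ⬝ᵥ a
  set β := f Q ⬝ᵥ a
  set α' := f I ⬝ᵥ a'
  set β' := f Q ⬝ᵥ a'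
  have hab : α * α + β * β = 1 := by
    rw [hsa] at ha1
    simp only [dotProduct_add, add_dotProduct, dotProduct_smul, smul_dotProduct, hII, hQQ, hIQ0,
      hQI0, smul_eq_mul] at ha1
    linarith
  have hca : a' = (α * α' + β * β') • a := by
    have e1 : α' = (α * α' + β * β') * α := by linear_combination (-α') * hab - β * hdet
    have e2 : β' = (α * α' + β * β') * β := by linear_combination (-β') * hab + α * hdet
    calc a' = α' • f I + β' • f Q := hsa'
      _ = ((α * α' + β * β') * α) • f I + ((α * α' + β * β') * β) • f Q := by rw [← e1, ← e2]
      _ = (α * α' + β * β') • a := by rw [mul_smul, mul_smul, ← smul_add, ← hsa]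
  set c := α * α' + β * β'
  have hc0 : c ≠ 0 := by
    intro h0
    rw [hca, h0, zero_smul] at ha1'
    simp at ha1'
  have h1 := hDa a hMa
  have h2 := hDa' a hMa
  rw [ha1, mul_one] at h1
  have hneg : (of (D (-e)) : Matrix m m ℝ) = -of (D e) := by
    rw [map_neg]
    rfl
  rw [hneg, hca, mulVec_smul, neg_mulVec, dotProduct_smul, dotProduct_neg, h1, dotProduct_smul, ha1,
    map_neg, map_neg, norm_neg] at h2
  simp only [smul_eq_mul, mul_one] at h2
  have h3 : 2 * c * (s * ‖L e‖) = 0 := by linear_combination -h2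
  have hLe : ‖L e‖ ≠ 0 := by
    intro h0
    have : e = 0 := hL (by rw [norm_eq_zero.1 h0, map_zero])
    rw [this] at he1
    simp at he1
  exact mul_ne_zero (mul_ne_zero two_ne_zero hc0) (mul_ne_zero hs hLe) h3

end Coalescing

/-! ### Monodromy of eigenlines -/

section Monodromy

variable {m : Type*} [Fintype m] [DecidableEq m]

/-- The eigenline of one of two generically coalescing eigenvalues has no lift over a closed curve
around the coalescing point. -/
theorem IsGenericCoalescing.not_hasLift_eigenline {M : Plane → Matrix m m ℝ} {C : Set Plane}
    (hC : IsCompact C) {x : Plane} (hx : x ∈ inside C) (hMc : ContinuousOn M (C ∪ inside C))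
    (hMs : ∀ y ∈ C ∪ inside C, (M y).IsSymm) {j : ℕ} (hj : j + 1 < Fintype.card m)
    (h : IsGenericCoalescing M j x)
    (hsep : ∀ l < Fintype.card m, l ≠ j → l ≠ j + 1 →
      orderedEigenvalue (M x) l ≠ orderedEigenvalue (M x) j)
    {i : ℕ} (hi : i = j ∨ i = j + 1) (hsimple : ∀ y ∈ (C ∪ inside C) \ {x}, IsSimple (M y) i) :
    ¬ HasLift (fun y : C => eigenline (M y) i) := by
  have hiN : i < Fintype.card m := by omega
  obtain ⟨hdiff, heq, l, L, hL, h1, h2⟩ := h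
  have hxs := hMs x (Or.inr hx)
  have hind : ∃ a b : m → ℝ, ∀ᶠ h in 𝓝[≠] (0 : Plane), ∀ v v' : m → ℝ,
      M (x + h) *ᵥ v = orderedEigenvalue (M (x + h)) i • v → v ⬝ᵥ v = 1 →
      M (x - h) *ᵥ v' = orderedEigenvalue (M (x - h)) i • v' → v' ⬝ᵥ v' = 1 →
      (a ⬝ᵥ v) * (b ⬝ᵥ v') ≠ (b ⬝ᵥ v) * (a ⬝ᵥ v') := by
    rcases hi with rfl | rfl
    · refine eventually_independent_of_cone hxs hdiff hiN hj (by omega) hsep hL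
        (one_ne_zero (α := ℝ)) (l := l) ?_
      simpa only [one_mul] using h1
    · refine eventually_independent_of_cone hxs hdiff hiN (q := j) (by omega) (by omega)
        (fun l hl h1 h2 => ?_) hL (s := -1) (by norm_num) (l := l) ?_
      · have heq : orderedEigenvalue (M x) j = orderedEigenvalue (M x) (j + 1) := heq
        rw [← heq]
        exact hsep l hl h2 h1
      · simpa only [neg_mul, one_mul, ← sub_eq_add_neg] using h2
  obtain ⟨a, b, hab⟩ := hind
  have hin : ∀ᶠ h in 𝓝[≠] (0 : Plane), x + h ∈ inside C ∧ x - h ∈ inside C := by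
    have ho := (isOpen_inside hC.isClosed).mem_nhds hx
    have t1 : Tendsto (fun h : Plane => x + h) (𝓝 0) (𝓝 x) := by
      simpa using (continuous_const_add x).tendsto 0
    have t2 : Tendsto (fun h : Plane => x - h) (𝓝 0) (𝓝 x) := by
      simpa using (continuous_sub_left x).tendsto 0
    exact nhdsWithin_le_nhds ((t1.eventually ho).and (t2.eventually ho))
  refine not_hasLift_of_antipodal hC hx (continuousOn_eigenline (hMc.mono sdiff_subset)
      (fun y hy => hMs y hy.1) hiN hsimple) (fun y hy => isLine_eigenline (hMs y hy.1) hiN)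
    (α := fun v => a ⬝ᵥ v) (β := fun v => b ⬝ᵥ v) (by fun_prop) (by fun_prop) ?_
  filter_upwards [hab, hin] with h hh hin v v' hv hv'
  obtain ⟨e1, e2⟩ := eigenvector_of_eigenline_eq (hMs _ (Or.inr hin.1)) hiN hv
  obtain ⟨e3, e4⟩ := eigenvector_of_eigenline_eq (hMs _ (Or.inr hin.2)) hiN hv'
  exact hh v v' e1 e2 e3 e4

/-- The Möbius family on the punctured plane: the line whose angle is half of the angle of `h`. The
spanning vector has length `√(2 ‖h‖)`, which makes the family continuous at `0`, with value `0`. -/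
noncomputable def halfAngleLine (h : Plane) : Matrix (Fin 2) (Fin 2) ℝ :=
  !![‖h‖ + h 0, h 1; h 1, ‖h‖ - h 0]

theorem norm_sq_plane (h : Plane) : ‖h‖ ^ 2 = h 0 ^ 2 + h 1 ^ 2 := by
  rw [EuclideanSpace.norm_sq_eq]
  simp

theorem continuous_halfAngleLine : Continuous halfAngleLine := by
  refine continuous_pi fun a => continuous_pi fun b => ?_
  fin_cases a <;> fin_cases b <;> simp [halfAngleLine] <;> fun_prop

theorem isLine_halfAngleLine {h : Plane} (hh : h ≠ 0) : IsLine (halfAngleLine h) := by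
  have hr : 0 < ‖h‖ := norm_pos_iff.2 hh
  have hn := norm_sq_plane h
  have h1 : 0 ≤ ‖h‖ + h 0 := by nlinarith [sq_nonneg (h 1)]
  have h2 : 0 ≤ ‖h‖ - h 0 := by nlinarith [sq_nonneg (h 1)]
  have h3 : √(‖h‖ + h 0) * √(‖h‖ - h 0) = |h 1| := by
    rw [← Real.sqrt_mul h1, ← Real.sqrt_sq_eq_abs]
    congr 1
    linarith
  obtain ⟨ε, hε, hε1⟩ : ∃ ε : ℝ, ε * ε = 1 ∧ ε * |h 1| = h 1 := by
    rcases le_total 0 (h 1) with h0 | h0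
    · exact ⟨1, by norm_num, by rw [abs_of_nonneg h0, one_mul]⟩
    · exact ⟨-1, by norm_num, by rw [abs_of_nonpos h0]; ring⟩
  have hw : halfAngleLine h =
      vecMulVec ![√(‖h‖ + h 0), ε * √(‖h‖ - h 0)] ![√(‖h‖ + h 0), ε * √(‖h‖ - h 0)] := by
    ext a b
    fin_cases a <;> fin_cases b <;> simp [halfAngleLine, vecMulVec_apply]
    · exact (Real.mul_self_sqrt h1).symm
    · linear_combination -hε1 - ε * h3
    · linear_combination -hε1 - ε * h3
    · linear_combination (-(√(‖h‖ - h 0) * √(‖h‖ - h 0))) * hε - Real.mul_self_sqrt h2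
  refine ⟨_, fun h0 => ?_, hw⟩
  rw [h0] at hw
  have e0 := congrFun (congrFun hw 0) 0
  have e1 := congrFun (congrFun hw 1) 1
  simp [halfAngleLine] at e0 e1
  linarith

/-- The tensor product of two matrices, indexed by pairs; for the matrices of two lines it is the
matrix of the tensor product of the lines. -/
noncomputable def tensorLine {ι κ : Type*} (P : Matrix ι ι ℝ) (R : Matrix κ κ ℝ) : Matrix (ι × κ) (ι × κ) ℝ :=
  of fun a b => P a.1 b.1 * R a.2 b.2

theorem tensorLine_vecMulVec {ι κ : Type*} (v : ι → ℝ) (w : κ → ℝ) :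
    tensorLine (vecMulVec v v) (vecMulVec w w) =
      vecMulVec (fun a : ι × κ => v a.1 * w a.2) (fun a : ι × κ => v a.1 * w a.2) := by
  ext a b
  simp only [tensorLine, of_apply, vecMulVec_apply]
  ring

theorem IsLine.tensorLine {ι κ : Type*} {P : Matrix ι ι ℝ} {R : Matrix κ κ ℝ} (hP : IsLine P)
    (hR : IsLine R) : IsLine (tensorLine P R) := by
  obtain ⟨v, hv, rfl⟩ := hP
  obtain ⟨w, hw, rfl⟩ := hR
  refine ⟨_, fun h0 => ?_, tensorLine_vecMulVec v w⟩
  obtain ⟨i, hi⟩ := Function.ne_iff.1 hv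
  obtain ⟨k, hk⟩ := Function.ne_iff.1 hw
  exact mul_ne_zero hi hk (congrFun h0 (i, k))

/-- Twisting a family of lines, defined on the whole enclosed region, by the Möbius family around an
enclosed point gives a family without lift over the curve. -/
theorem not_hasLift_tensorLine_halfAngleLine {ι : Type*} [Fintype ι] {C : Set Plane}
    (hC : IsCompact C) {x : Plane} (hx : x ∈ inside C) {P : Plane → Matrix ι ι ℝ}
    (hP : ContinuousOn P (C ∪ inside C)) (hl : ∀ y ∈ C ∪ inside C, IsLine (P y)) :
    ¬ HasLift (fun y : C => tensorLine (P y) (halfAngleLine (y - x))) := by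
  obtain ⟨u, hu, hPu⟩ := hl x (Or.inr hx)
  have hpos : ∀ᶠ y in 𝓝 x, 0 < u ⬝ᵥ P y *ᵥ u := by
    have ho := (isOpen_inside hC.isClosed).mem_nhds hx
    have hc : ContinuousAt P x := hP.continuousAt (mem_of_superset ho subset_union_right)
    have hc2 : Continuous fun R : Matrix ι ι ℝ => u ⬝ᵥ R *ᵥ u := by fun_prop
    refine (hc2.continuousAt.comp hc).eventually (lt_mem_nhds ?_)
    have huu : 0 < u ⬝ᵥ u := by
      have := dotProduct_self_star_pos_iff (v := u)
      simpa using this.2 hu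
    simp only [Function.comp_apply]
    rw [hPu, vecMulVec_mulVec]
    simp
    positivity
  have hcontr : ∀ (R : Matrix ι ι ℝ) (T : Matrix (Fin 2) (Fin 2) ℝ) (z : ι × Fin 2 → ℝ),
      tensorLine R T = vecMulVec z z → ∀ k k',
        (∑ a, u a * z (a, k)) * (∑ a, u a * z (a, k')) = (u ⬝ᵥ R *ᵥ u) * T k k' := by
    intro R T z hz k k'
    rw [Finset.sum_mul_sum]
    simp only [dotProduct, mulVec, Finset.mul_sum, Finset.sum_mul]
    refine Finset.sum_congr rfl fun a _ => Finset.sum_congr rfl fun b _ => ?_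
    have : R a b * T k k' = z (a, k) * z (b, k') := congrFun (congrFun hz (a, k)) (b, k')
    linear_combination -(u a * u b) * this
  refine not_hasLift_of_antipodal hC hx ?_
    (fun y hy => (hl y hy.1).tensorLine (isLine_halfAngleLine (sub_ne_zero.2 hy.2)))
    (α := fun z => ∑ a, u a * z (a, 0)) (β := fun z => ∑ a, u a * z (a, 1))
    (by fun_prop) (by fun_prop) ?_
  · have hP' := hP.mono (sdiff_subset (t := {x}))
    have hm : ContinuousOn (fun y => halfAngleLine (y - x)) ((C ∪ inside C) \ {x}) :=
      (continuous_halfAngleLine.comp (continuous_sub_right x)).continuousOn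
    refine continuousOn_pi.2 fun a => continuousOn_pi.2 fun b => ?_
    exact (continuousOn_pi.1 (continuousOn_pi.1 hP' a.1) b.1).mul
      (continuousOn_pi.1 (continuousOn_pi.1 hm a.2) b.2)
  · have t1 : Tendsto (fun h : Plane => x + h) (𝓝 0) (𝓝 x) := by
      simpa using (continuous_const_add x).tendsto 0
    have t2 : Tendsto (fun h : Plane => x - h) (𝓝 0) (𝓝 x) := by
      simpa using (continuous_sub_left x).tendsto 0
    filter_upwards [nhdsWithin_le_nhds (t1.eventually hpos), nhdsWithin_le_nhds (t2.eventually hpos),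
      self_mem_nhdsWithin] with h hp hp' hh z z' hz hz' heq
    have c := hcontr _ _ _ hz
    have c' := hcontr _ _ _ hz'
    have hr : 0 < ‖h‖ := norm_pos_iff.2 hh
    have hn := norm_sq_plane h
    have e1 : x + h - x = h := add_sub_cancel_left x h
    have e2 : x - h - x = -h := by abel
    simp only [e1, e2] at c c'
    have c00 := c 0 0
    have c01 := c 0 1
    have c11 := c 1 1
    have d00 := c' 0 0
    have d01 := c' 0 1
    have d11 := c' 1 1
    simp [halfAngleLine, -mul_eq_mul_left_iff, -mul_eq_mul_right_iff] at c00 c01 c11 d00 d01 d11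
    set p := u ⬝ᵥ P (x + h) *ᵥ u
    set p' := u ⬝ᵥ P (x - h) *ᵥ u
    set A := ∑ a, u a * z (a, 0)
    set B := ∑ a, u a * z (a, 1)
    set A' := ∑ a, u a * z' (a, 0)
    set B' := ∑ a, u a * z' (a, 1)
    have h0 : (A * B' - B * A') ^ 2 = 4 * (p * p' * ‖h‖ ^ 2) := by
      calc (A * B' - B * A') ^ 2 = (A * A) * (B' * B') + (B * B) * (A' * A')
            - 2 * (A * B) * (A' * B') := by ring
        _ = _ := by
          rw [c00, c01, c11, d00, d01, d11]
          linear_combination (-2 * p * p') * hn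
    rw [sub_eq_zero.2 heq] at h0
    have : 0 < p * p' * ‖h‖ ^ 2 := by positivity
    nlinarith

theorem not_hasLift_halfAngleLine {C : Set Plane} (hC : IsCompact C) {x : Plane}
    (hx : x ∈ inside C) : ¬ HasLift (fun y : C => halfAngleLine (y - x)) := by
  rintro ⟨w, hw, h⟩
  refine not_hasLift_tensorLine_halfAngleLine (ι := Unit) hC hx
    (P := fun _ => vecMulVec (fun _ => 1) (fun _ => 1)) continuousOn_const
    (fun _ _ => isLine_vecMulVec fun h0 => one_ne_zero (congrFun h0 ())) ?_
  refine ⟨fun y a => 1 * w y a.2, by fun_prop, fun y => ?_⟩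
  have e : halfAngleLine ((y : Plane) - x) = _ := h y
  change tensorLine _ (halfAngleLine ((y : Plane) - x)) = _
  rw [e, tensorLine_vecMulVec]

/-- A family of lines that is defined on the whole enclosed region has trivial monodromy along a
simple closed curve: a lift with a sign change, multiplied by a lift of the Möbius family, would
be a lift of the twisted family over the curve. -/
theorem lift_closed_of_enclosed {ι : Type*} [Fintype ι] {γ : ℝ → Plane}
    (hγ : ContinuousOn γ (Icc 0 1)) (hsimple : InjOn γ (Ico 0 1)) (hclosed : γ 0 = γ 1)
    {x : Plane} (hx : x ∈ inside (γ '' Icc 0 1)) {P : Plane → Matrix ι ι ℝ}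
    (hP : ContinuousOn P (γ '' Icc 0 1 ∪ inside (γ '' Icc 0 1)))
    (hl : ∀ y ∈ γ '' Icc 0 1 ∪ inside (γ '' Icc 0 1), IsLine (P y)) {v : ℝ → ι → ℝ}
    (hv : ContinuousOn v (Icc 0 1)) (hPv : ∀ t ∈ Icc (0 : ℝ) 1, P (γ t) = vecMulVec (v t) (v t)) :
    v 1 = v 0 := by
  have h0 : (0 : ℝ) ∈ Icc (0 : ℝ) 1 := by simp
  have h1 : (1 : ℝ) ∈ Icc (0 : ℝ) 1 := by simp
  have hC : IsCompact (γ '' Icc 0 1) := isCompact_Icc.image_of_continuousOn hγ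
  have hne : ∀ t ∈ Icc (0 : ℝ) 1, γ t - x ≠ 0 := fun t ht h =>
    hx.1 ((sub_eq_zero.1 h) ▸ mem_image_of_mem γ ht)
  have hm : ContinuousOn (fun t => halfAngleLine (γ t - x)) (Icc 0 1) :=
    continuous_halfAngleLine.comp_continuousOn (hγ.sub continuousOn_const)
  obtain ⟨w, hw, hPw⟩ := hasLift_Icc (continuousOn_iff_continuous_domRestrict.1 hm)
    fun t => isLine_halfAngleLine (hne t t.2)
  set W : ℝ → Fin 2 → ℝ := IccExtend (zero_le_one (α := ℝ)) w
  have hW : Continuous W := hw.Icc_extend'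
  have hPW : ∀ t ∈ Icc (0 : ℝ) 1, halfAngleLine (γ t - x) = vecMulVec (W t) (W t) := by
    intro t ht
    simp only [W, IccExtend_of_mem _ _ ht]
    exact hPw ⟨t, ht⟩
  have hW10 : W 1 = -W 0 := by
    have e : vecMulVec (W 1) (W 1) = vecMulVec (W 0) (W 0) := by
      rw [← hPW 1 h1, ← hPW 0 h0, hclosed]
    refine (eq_or_eq_neg_of_vecMulVec_eq e).resolve_left fun e => ?_
    exact not_hasLift_halfAngleLine hC hx
      (hasLift_image_of_closed hγ hsimple hclosed (P := fun y => halfAngleLine (y - x))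
        hW.continuousOn hPW e.symm)
  have e : vecMulVec (v 1) (v 1) = vecMulVec (v 0) (v 0) := by
    rw [← hPv 1 h1, ← hPv 0 h0, hclosed]
  refine (eq_or_eq_neg_of_vecMulVec_eq e).resolve_right fun e => ?_
  refine not_hasLift_tensorLine_halfAngleLine hC hx hP hl
    (hasLift_image_of_closed hγ hsimple hclosed
      (P := fun y => tensorLine (P y) (halfAngleLine (y - x)))
      (v := fun t a => v t a.1 * W t a.2) ?_ (fun t ht => ?_) ?_)
  · refine continuousOn_pi.2 fun a => (continuousOn_pi.1 hv a.1).mul ?_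
    exact ((continuous_apply a.2).comp hW).continuousOn
  · simp only [hPv t ht, hPW t ht, tensorLine_vecMulVec]
  · ext a
    simp [e, hW10]

end Monodromy

/-! ### Monodromy of Takagi factors -/

section Main

variable {n : ℕ}

/-- In a decreasing finite sequence, an entry that differs from its neighbours differs from all
other entries. -/
theorem singularValue_ne_of_neighbours {A : Matrix (Fin n) (Fin n) ℂ} {c : ℕ} (hc : c < n)
    (h1 : ∀ i, i + 1 = c → singularValue A i ≠ singularValue A c)
    (h2 : c + 1 < n → singularValue A c ≠ singularValue A (c + 1)) :
    ∀ l < n, l ≠ c → singularValue A l ≠ singularValue A c := by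
  have hanti : ∀ {i j : ℕ}, i ≤ j → singularValue A j ≤ singularValue A i := fun h =>
    (toEuclideanLin A).singularValues_antitone h
  intro l hl hlc
  rcases lt_or_gt_of_ne hlc with h | h
  · obtain ⟨c, rfl⟩ : ∃ d, c = d + 1 := ⟨c - 1, by omega⟩
    exact ne_of_gt ((lt_of_le_of_ne (hanti c.le_succ) (h1 c rfl).symm).trans_le
      (hanti (by omega)))
  · exact ne_of_lt ((hanti (show c + 1 ≤ l from h)).trans_lt
      (lt_of_le_of_ne (hanti c.le_succ) (h2 (by omega)).symm))

variable {k : ℕ∞} {A : Plane → Matrix (Fin n) (Fin n) ℂ} {γ : ℝ → Plane}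
  {U : ℝ → Matrix (Fin n) (Fin n) ℂ} {S : ℝ → Fin n → ℝ}

theorem IsSmoothTakagi.eigenline_eq (h : IsSmoothTakagi k (fun t => A (γ t)) U S)
    (hA : ∀ t ∈ Icc (0 : ℝ) 1, (A (γ t))ᵀ = A (γ t)) {c : Fin n}
    (hs : ∀ t ∈ Icc (0 : ℝ) 1, IsSimple (realForm (A (γ t))) c) {t : ℝ} (ht : t ∈ Icc (0 : ℝ) 1) :
    eigenline (realForm (A (γ t))) c =
      vecMulVec (realVec ((U t).col c)) (realVec ((U t).col c)) :=
  (h.takagi t ht).eigenline_eq (hA t ht) (hs t ht)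

/-- A column whose eigenline has no lift over the closed curve changes its sign. -/
theorem IsSmoothTakagi.col_eq_neg (h : IsSmoothTakagi k (fun t => A (γ t)) U S)
    (hγ : ContinuousOn γ (Icc 0 1)) (hsimple : InjOn γ (Ico 0 1)) (hclosed : γ 0 = γ 1)
    (hA : ∀ t ∈ Icc (0 : ℝ) 1, (A (γ t))ᵀ = A (γ t)) {c : Fin n}
    (hs : ∀ t ∈ Icc (0 : ℝ) 1, IsSimple (realForm (A (γ t))) c)
    (hlift : ¬ HasLift (fun y : γ '' Icc 0 1 => eigenline (realForm (A y)) c)) :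
    (U 1).col c = -(U 0).col c := by
  have e : vecMulVec (realVec ((U 1).col c)) (realVec ((U 1).col c)) =
      vecMulVec (realVec ((U 0).col c)) (realVec ((U 0).col c)) := by
    rw [← h.eigenline_eq hA hs (by simp), ← h.eigenline_eq hA hs (by simp), hclosed]
  apply realVec_injective
  rw [realVec_neg]
  refine (eq_or_eq_neg_of_vecMulVec_eq e).resolve_left fun e => hlift ?_
  exact hasLift_image_of_closed hγ hsimple hclosed (P := fun y => eigenline (realForm (A y)) c)
    (h.continuousOn_realVec c) (fun t ht => h.eigenline_eq hA hs ht) e.symm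

/-- A column belonging to a singular value that is simple on the whole enclosed region returns to
its initial value. -/
theorem IsSmoothTakagi.col_eq (h : IsSmoothTakagi k (fun t => A (γ t)) U S)
    (hγ : ContinuousOn γ (Icc 0 1)) (hsimple : InjOn γ (Ico 0 1)) (hclosed : γ 0 = γ 1)
    {x : Plane} (hx : x ∈ inside (γ '' Icc 0 1))
    (hA : ∀ y ∈ γ '' Icc 0 1 ∪ inside (γ '' Icc 0 1), (A y)ᵀ = A y)
    (hAc : ContinuousOn (fun y => realForm (A y)) (γ '' Icc 0 1 ∪ inside (γ '' Icc 0 1)))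
    {c : Fin n}
    (hs : ∀ y ∈ γ '' Icc 0 1 ∪ inside (γ '' Icc 0 1), IsSimple (realForm (A y)) c) :
    (U 1).col c = (U 0).col c := by
  have hγK : ∀ t ∈ Icc (0 : ℝ) 1, γ t ∈ γ '' Icc 0 1 ∪ inside (γ '' Icc 0 1) := fun t ht =>
    Or.inl (mem_image_of_mem γ ht)
  apply realVec_injective
  exact lift_closed_of_enclosed hγ hsimple hclosed hx
    (P := fun y => eigenline (realForm (A y)) c)
    (continuousOn_eigenline hAc (fun y hy => isSymm_realForm (hA y hy)) (lt_card_sum c.2) hs)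
    (fun y hy => isLine_eigenline (isSymm_realForm (hA y hy)) (lt_card_sum c.2))
    (v := fun t => realVec ((U t).col c)) (h.continuousOn_realVec c)
    fun t ht => h.eigenline_eq (fun t ht => hA _ (hγK t ht)) (fun t ht => hs _ (hγK t ht)) ht

end Main

end Takagi

theorem theorem2p3 (n : ℕ) (k : ℕ∞)
    (Ω : Set Takagi.Plane) (hΩ : IsCompact Ω)
    (A : Takagi.Plane → Matrix (Fin n) (Fin n) ℂ)
    (hA : ∀ r c, ContDiffOn ℝ k (fun y => A y r c) Ω)
    (hAsymm : ∀ y ∈ Ω, (A y)ᵀ = A y)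
    -- `γ` parametrizes a simple closed curve in `Ω`, and `Ω` contains the region it encloses
    (γ : ℝ → Takagi.Plane) (hγ : ContDiffOn ℝ k γ (Icc 0 1))
    (hγclosed : γ 0 = γ 1) (hγsimple : InjOn γ (Ico 0 1))
    (hγΩ : MapsTo γ (Icc 0 1) Ω) (hinside : Takagi.inside (γ '' Icc 0 1) ⊆ Ω)
    -- along the curve the singular values are distinct and nonzero
    (hdistinct : ∀ t ∈ Icc (0 : ℝ) 1, InjOn (Takagi.singularValue (A (γ t))) (Iio n))
    (hnonzero : ∀ t ∈ Icc (0 : ℝ) 1, ∀ i < n, Takagi.singularValue (A (γ t)) i ≠ 0)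
    -- a given Takagi factorization at `t = 0`
    (U₀ : Matrix (Fin n) (Fin n) ℂ) (S₀ : Fin n → ℝ) (h₀ : Takagi.IsTakagi (A (γ 0)) U₀ S₀) :
    -- the unique smooth continuation of the given factorization along the curve
    ∃ (U : ℝ → Matrix (Fin n) (Fin n) ℂ) (S : ℝ → Fin n → ℝ),
      Takagi.IsSmoothTakagi k (fun t => A (γ t)) U S ∧ U 0 = U₀ ∧ S 0 = S₀ ∧
      (∀ (U' : ℝ → Matrix (Fin n) (Fin n) ℂ) (S' : ℝ → Fin n → ℝ),
        Takagi.IsSmoothTakagi k (fun t => A (γ t)) U' S' → U' 0 = U₀ → S' 0 = S₀ →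
          EqOn U' U (Icc 0 1) ∧ EqOn S' S (Icc 0 1)) ∧
      -- a unique degeneracy in `Ω`, a generic coalescing of the `j`-th and `(j+1)`-st values
      (∀ (x : Takagi.Plane) (j : ℕ), x ∈ Takagi.inside (γ '' Icc 0 1) → j + 1 < n →
        Takagi.IsGenericCoalescing (fun y => Takagi.realForm (A y)) j x →
        (∀ y ∈ Ω, ∀ i, i + 1 < n →
          (Takagi.singularValue (A y) i = Takagi.singularValue (A y) (i + 1) ↔ y = x ∧ i = j)) →
        (∀ y ∈ Ω, ∀ i < n, Takagi.singularValue (A y) i ≠ 0) →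
        ∀ c : Fin n,
          ((c : ℕ) ≠ j → (c : ℕ) ≠ j + 1 → (U 1).col c = (U 0).col c) ∧
          ((c : ℕ) = j ∨ (c : ℕ) = j + 1 → (U 1).col c = -(U 0).col c)) ∧
      -- a unique, generic, zero of the last singular value, which is simple throughout `Ω`
      (∀ (x : Takagi.Plane) (hn : 0 < n), x ∈ Takagi.inside (γ '' Icc 0 1) →
        Takagi.IsGenericCoalescing (fun y => Takagi.realForm (A y)) (n - 1) x →
        (∀ y ∈ Ω, (Takagi.singularValue (A y) (n - 1) = 0 ↔ y = x)) →
        (∀ y ∈ Ω, ∀ i, i + 2 = n →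
          Takagi.singularValue (A y) i ≠ Takagi.singularValue (A y) (i + 1)) →
        (U 1).col ⟨n - 1, Nat.sub_lt hn Nat.one_pos⟩ =
          -(U 0).col ⟨n - 1, Nat.sub_lt hn Nat.one_pos⟩) := by
  have hγc := hγ.continuousOn
  have hA' : ∀ t ∈ Icc (0 : ℝ) 1, (A (γ t))ᵀ = A (γ t) := fun t ht => hAsymm _ (hγΩ ht)
  have hs : ∀ t ∈ Icc (0 : ℝ) 1, ∀ i < n, Takagi.IsSimple (Takagi.realForm (A (γ t))) i :=
    fun t ht i hi => Takagi.isSimple_realForm (hA' t ht) hi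
      (fun j hj hji e => hji (hdistinct t ht hj hi e)) (hnonzero t ht i hi)
  obtain ⟨U, S, hUS, hU0, hS0⟩ := Takagi.exists_isSmoothTakagi (k := k) (A := fun t => A (γ t))
    (fun r c => (hA r c).comp hγ hγΩ) hA' hdistinct hs h₀
  have hC : IsCompact (γ '' Icc 0 1) := isCompact_Icc.image_of_continuousOn hγc
  have hK : γ '' Icc 0 1 ∪ Takagi.inside (γ '' Icc 0 1) ⊆ Ω :=
    union_subset hγΩ.image_subset hinside
  have hMc : ContinuousOn (fun y => Takagi.realForm (A y))
      (γ '' Icc 0 1 ∪ Takagi.inside (γ '' Icc 0 1)) :=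
    (Takagi.continuousOn_realForm fun r c => (hA r c).continuousOn).mono hK
  have hMs : ∀ y ∈ γ '' Icc 0 1 ∪ Takagi.inside (γ '' Icc 0 1), (Takagi.realForm (A y)).IsSymm :=
    fun y hy => Takagi.isSymm_realForm (hAsymm y (hK hy))
  refine ⟨U, S, hUS, hU0, hS0, ?_, ?_, ?_⟩
  · intro U' S' h' hU' _
    exact hUS.eqOn h' hA' hs (hU'.trans hU0.symm)
  · intro x j hx hj hgen hdeg hnz c
    have hxΩ : x ∈ Ω := hinside hx
    constructor
    · intro hcj hcj1
      refine hUS.col_eq hγc hγsimple hγclosed hx (fun y hy => hAsymm y (hK hy)) hMc fun y hy => ?_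
      refine Takagi.isSimple_realForm (hAsymm y (hK hy)) c.2
        (Takagi.singularValue_ne_of_neighbours c.2 (fun i hi e => ?_) fun hc e => ?_)
        (hnz y (hK hy) c c.2)
      · rw [← hi] at e
        have := ((hdeg y (hK hy) i (by omega)).1 e).2
        omega
      · exact hcj ((hdeg y (hK hy) c hc).1 e).2
    · intro hc
      refine hUS.col_eq_neg hγc hγsimple hγclosed hA' (fun t ht => hs t ht c c.2)
        (hgen.not_hasLift_eigenline hC hx hMc hMs (Takagi.lt_card_sum hj) ?_ hc ?_)
      · intro l hl hlj hlj1
        rw [Takagi.orderedEigenvalue_realForm (hAsymm x hxΩ) (show j < n by omega)]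
        have hxj : Takagi.singularValue (A x) j = Takagi.singularValue (A x) (j + 1) :=
          (hdeg x hxΩ j hj).2 ⟨rfl, rfl⟩
        have hanti : ∀ {i j : ℕ}, i ≤ j →
            Takagi.singularValue (A x) j ≤ Takagi.singularValue (A x) i := fun h =>
          (toEuclideanLin (A x)).singularValues_antitone h
        rcases lt_or_ge l n with hln | hln
        · rw [Takagi.orderedEigenvalue_realForm (hAsymm x hxΩ) hln]
          rcases lt_or_gt_of_ne hlj with h | h
          · have h1 : Takagi.singularValue (A x) (j - 1) ≠ Takagi.singularValue (A x) j := by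
              intro e
              have := ((hdeg x hxΩ (j - 1) (by omega)).1 (by rwa [Nat.sub_add_cancel (by omega)])).2
              omega
            exact ne_of_gt ((lt_of_le_of_ne (hanti (j.sub_le 1)) h1.symm).trans_le
              (hanti (by omega)))
          · have h1 : Takagi.singularValue (A x) (j + 1) ≠
                Takagi.singularValue (A x) (j + 1 + 1) := by
              intro e
              have := ((hdeg x hxΩ (j + 1) (by omega)).1 e).2
              omega
            rw [hxj]
            exact ne_of_lt ((hanti (show j + 1 + 1 ≤ l by omega)).trans_lt
              (lt_of_le_of_ne (hanti (j + 1).le_succ) h1.symm))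
        · obtain ⟨i, rfl⟩ := Nat.exists_eq_add_of_le hln
          simp only [Fintype.card_sum, Fintype.card_fin] at hl
          rw [Takagi.orderedEigenvalue_realForm_add (hAsymm x hxΩ) (by omega)]
          have h1 := Takagi.singularValue_nonneg (A x) (n - 1 - i)
          have h2 := (Takagi.singularValue_nonneg (A x) j).lt_of_ne' (hnz x hxΩ j (by omega))
          linarith
      · intro y hy
        have hyx : y ≠ x := hy.2
        have hyΩ := hK hy.1
        refine Takagi.isSimple_realForm (hAsymm y hyΩ) c.2
          (Takagi.singularValue_ne_of_neighbours c.2 (fun i hi e => ?_) fun hc e => ?_)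
          (hnz y hyΩ c c.2)
        · rw [← hi] at e
          exact hyx ((hdeg y hyΩ i (by omega)).1 e).1
        · exact hyx ((hdeg y hyΩ c hc).1 e).1
  · intro x hn hx hgen hzero hsep
    have hxΩ : x ∈ Ω := hinside hx
    have hlast : ∀ y ∈ Ω, ∀ l < n, l ≠ n - 1 →
        Takagi.singularValue (A y) l ≠ Takagi.singularValue (A y) (n - 1) := fun y hy =>
      Takagi.singularValue_ne_of_neighbours (by omega)
        (fun i hi => by
          have := hsep y hy i (by omega)
          rwa [hi] at this)
        (fun h => by omega)
    have hx0 : Takagi.singularValue (A x) (n - 1) = 0 := (hzero x hxΩ).2 rfl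
    refine hUS.col_eq_neg hγc hγsimple hγclosed hA' (fun t ht => hs t ht _ (Nat.sub_lt hn one_pos))
      (hgen.not_hasLift_eigenline hC hx hMc hMs ?_ ?_ (Or.inl rfl) ?_)
    · simp only [Fintype.card_sum, Fintype.card_fin]
      omega
    · intro l hl hl1 hl2
      simp only [Fintype.card_sum, Fintype.card_fin] at hl
      rw [Takagi.orderedEigenvalue_realForm (hAsymm x hxΩ) (Nat.sub_lt hn one_pos)]
      rcases lt_or_ge l n with hln | hln
      · rw [Takagi.orderedEigenvalue_realForm (hAsymm x hxΩ) hln]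
        exact hlast x hxΩ l hln hl1
      · obtain ⟨i, rfl⟩ := Nat.exists_eq_add_of_le hln
        rw [Takagi.orderedEigenvalue_realForm_add (hAsymm x hxΩ) (by omega), hx0, ne_eq,
          neg_eq_zero, ← hx0]
        exact hlast x hxΩ _ (by omega) (by omega)
    · intro y hy
      have hyΩ := hK hy.1
      exact Takagi.isSimple_realForm (hAsymm y hyΩ) (Nat.sub_lt hn one_pos) (hlast y hyΩ)
        fun h => hy.2 ((hzero y hyΩ).1 h)
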